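/- For integers $m\ge 2$ and $n\ge 3$, the generalized closed web $CW_{m,n}$ is the graph obtained from the generalized prism $P_m\,\Box\,C_n$ (the Cartesian product of the path on $m$ vertices and the cycle on $n$ vertices) by adding one new vertex and joining it by an edge to every vertex of the top cycle (the copy of $C_n$ at one end of the path $P_m$). For a graph $G=(V,E)$ with $q$ edges and an Abelian group $\Gamma$ of order $q$, we say that $G$ is $\Gamma$-harmonious if there is an injection $f\colon V\to\Gamma$ such that $xy\mapsto f(x)+f(y)$ is a bijection from $E$ to $\Gamma$. A finite Abelian group $\Gamma$ is written in nested form as $\Gamma\cong\mathbb Z_{n_1}\oplus\mathbb Z_{n_2}\oplus\dots\oplus\mathbb Z_{n_t}$ if $n_t\ge 2$, $|\Gamma|=n_1n_2\cdots n_t$ and $n_{i+1}\mid n_i$ for $i=1,\dots,t-1$. **Corollary.** Let $n\ge 4$ be even, let $m\ge 2$, and let $\Gamma$ be an Abelian group of order $2mn$, written in nested form as $\Gamma\cong\mathbb Z_{n_1}\oplus\mathbb Z_{n_2}\oplus\dots\oplus\mathbb Z_{n_t}$ with $t\ge 2$, which has a cyclic subgroup of order $2m$. Suppose that at least one of the following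 conditions holds: 1. $n_1\equiv 0\pmod{8m}$ and $n_2\equiv 0\pmod 2$; 2. $n_1\equiv 0\pmod{4m}$, $n_2\equiv 0\pmod 2$ and $n_2\ge 4$; 3. $t\ge 3$, $n_1\equiv 0\pmod{2m}$, $n_2\equiv 0\pmod 4$ and $n_3\equiv 0\pmod 2$; 4. $t\ge 3$, $n_1\equiv 0\pmod{2m}$, $n_3\equiv 0\pmod 2$, and $n_t>1$ is odd. Then the closed web $CW_{m,n}$ is $\Gamma$-harmonious. -/

import Mathlib

/-- The generalized closed web `CW_{m,n}`: the generalized prism `P_m □ C_n`, with vertices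
`some (j, i)` (`j` the index of the copy of the cycle, `i` the position on that copy), together
with a new central vertex `none`, joined by an edge to every vertex of the top cycle `j = 0`. -/
def closedWeb (m n : ℕ) : SimpleGraph (Option (Fin m × Fin n)) where
  Adj
    | none, none => False
    | none, some q => (q.1 : ℕ) = 0
    | some p, none => (p.1 : ℕ) = 0
    | some p, some q =>
        (SimpleGraph.boxProd (SimpleGraph.pathGraph m) (SimpleGraph.cycleGraph n)).Adj p q
  symm := ⟨by
    rintro (_ | p) (_ | q) h
    · exact h
    · exact h
    · exact h
    · exact SimpleGraph.Adj.symm h⟩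
  loopless := ⟨by
    rintro (_ | p) h
    · exact h
    · exact SimpleGraph.irrefl _ h⟩

/-- The label `w(xy) = f(x) + f(y)` which a vertex labeling `f` induces on the edge `xy`. -/
def inducedLabel {V Γ : Type*} [AddCommGroup Γ] (f : V → Γ) : Sym2 V → Γ :=
  Sym2.lift ⟨fun x y => f x + f y, fun x y => add_comm (f x) (f y)⟩

/-- `G` is `Γ`-harmonious: some injective vertex labeling `f : V → Γ` induces a bijection from the
edge set of `G` onto `Γ` (so that the number of edges of `G` is the order of `Γ`). -/
def IsHarmonious {V : Type*} (G : SimpleGraph V) (Γ : Type*) [AddCommGroup Γ] : Prop :=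
  ∃ f : V → Γ, Function.Injective f ∧
    Function.Bijective (fun e : G.edgeSet => inducedLabel f (e : Sym2 V))

/-- `Γ ≅ Z_{ν 0} ⊕ Z_{ν 1} ⊕ ⋯ ⊕ Z_{ν (t - 1)}` is a nested form of `Γ`: every `ν i` is at least
`2`, and each `ν (i + 1)` divides `ν i`. -/
def IsNestedForm (Γ : Type*) [AddCommGroup Γ] {t : ℕ} (ν : Fin t → ℕ) : Prop :=
  (∀ i, 2 ≤ ν i) ∧
  (∀ i j : Fin t, (j : ℕ) = (i : ℕ) + 1 → ν j ∣ ν i) ∧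
  Nonempty (Γ ≃+ ((i : Fin t) → ZMod (ν i)))

/-!
Let `h` have order `2 * m` in `Γ` and generate a subgroup `H` of index `n`. Suppose that a cyclic
sequence `a` represents every coset of `H` once, and that the sums of two consecutive terms are the
terms of `a` again, in some order. Label the center by `-h` and the `j`-th cycle by `a + j • h`,
rotated by one place from each cycle to the next. Write `b` for the sequence of sums: the edges of
the `j`-th cycle then receive `b + (2 * j) • h`, those between the cycles `j` and `j + 1` receive
`b + (2 * j + 1) • h`, and those at the center receive `a - h`, which is a permutation of
`b + (2 * m - 1) • h`. So every element of `Γ` occurs exactly once.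

To find `a`, map `ℤ × D` to `Γ` so that `(2 * k, 0)` goes to a generator of a subgroup of `H`, for
a suitable `k` and a complement `D`. A sequence for a quotient of `D` by a subgroup `A` of odd prime
order, or of order `4`, lifts to `D`: each step is replaced by `Nat.card A` steps among the lifts of
its two ends. This reduces `D` to the groups of order `2` and `4`, or, for `k = 1`, to
`ZMod 4`, `ZMod 8` and `ZMod 4 × ZMod 2`; there explicit zigzags between the rows of `ℤ × D` do it.
-/

/-- The cyclic sequence `a` is a harmonious transversal of `H`: it meets each coset of `H` exactly
once, and each of its terms is the sum of two cyclically consecutive ones. The cyclic sequence is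
encoded as a sequence on `ℕ` whose period is the index of `H`. -/
structure IsHarmoniousTransversal {G : Type*} [AddCommGroup G] (H : AddSubgroup G) (a : ℕ → G) :
    Prop where
  periodic : Function.Periodic a H.index
  surjective : Function.Surjective fun i => (a i : G ⧸ H)
  exists_add_succ_eq : ∀ i, ∃ j, a j + a (j + 1) = a i

theorem eq_of_periodic_of_modEq {α : Type*} {a : ℕ → α} {n i j : ℕ} (hper : Function.Periodic a n)
    (hij : i ≡ j [MOD n]) : a i = a j :=
  (hper.map_mod_nat i).symm.trans ((congrArg a hij).trans (hper.map_mod_nat j))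

theorem modEq_of_periodic_of_surjective {α : Type*} [Finite α] {a : ℕ → α}
    (hper : Function.Periodic a (Nat.card α)) (hsurj : Function.Surjective a) {i j : ℕ}
    (hij : a i = a j) : i ≡ j [MOD Nat.card α] := by
  have : Nonempty α := ⟨a 0⟩
  have hsurj' : Function.Surjective fun i : Fin (Nat.card α) => a i := fun x => by
    obtain ⟨i, rfl⟩ := hsurj x
    exact ⟨⟨i % Nat.card α, Nat.mod_lt _ Nat.card_pos⟩, hper.map_mod_nat i⟩
  have hinj := (hsurj'.bijective_of_nat_card_le (by simp)).injective
  exact Fin.mk.inj (@hinj ⟨_, Nat.mod_lt i Nat.card_pos⟩ ⟨_, Nat.mod_lt j Nat.card_pos⟩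
    ((hper.map_mod_nat i).trans (hij.trans (hper.map_mod_nat j).symm)))

theorem exists_fin_add_eq_of_periodic {α : Type*} {a : ℕ → α} {n : ℕ} [NeZero n]
    (hper : Function.Periodic a n) (j s : ℕ) :
    ∃ i : Fin n, a (j + i) = a s ∧ a (j + i + 1) = a (s + 1) := by
  have hjs : j + (s + j * (n - 1)) = s + n * j := by
    obtain ⟨n, rfl⟩ := Nat.exists_eq_succ_of_ne_zero (NeZero.ne n)
    simp only [Nat.succ_eq_add_one, Nat.add_sub_cancel]
    ring
  have hmod : j + (s + j * (n - 1)) % n ≡ s [MOD n] :=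
    ((Nat.mod_modEq _ n).add_left j).trans (hjs ▸ Nat.add_modulus_mul_modEq_iff.2 rfl)
  exact ⟨Fin.ofNat n (s + j * (n - 1)), eq_of_periodic_of_modEq hper hmod,
    eq_of_periodic_of_modEq hper (hmod.add_right 1)⟩

namespace IsHarmoniousTransversal

variable {G : Type*} [AddCommGroup G] {H : AddSubgroup G} {a : ℕ → G} {i j : ℕ}

theorem eq_of_modEq (ha : IsHarmoniousTransversal H a) (hij : i ≡ j [MOD H.index]) : a i = a j :=
  eq_of_periodic_of_modEq ha.periodic hij

theorem surjective_mk_add_succ (ha : IsHarmoniousTransversal H a) :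
    Function.Surjective fun i => ((a i + a (i + 1) : G) : G ⧸ H) := fun x => by
  obtain ⟨i, rfl⟩ := ha.surjective x
  obtain ⟨j, hj⟩ := ha.exists_add_succ_eq i
  exact ⟨j, congrArg _ hj⟩

variable [H.FiniteIndex]

theorem modEq_of_mk_eq (ha : IsHarmoniousTransversal H a) (hij : (a i : G ⧸ H) = a j) :
    i ≡ j [MOD H.index] :=
  modEq_of_periodic_of_surjective (ha.periodic.comp _) ha.surjective hij

theorem modEq_of_mk_add_succ_eq (ha : IsHarmoniousTransversal H a)
    (hij : ((a i + a (i + 1) : G) : G ⧸ H) = (a j + a (j + 1) : G)) : i ≡ j [MOD H.index] := by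
  refine modEq_of_periodic_of_surjective (fun i => ?_) ha.surjective_mk_add_succ hij
  change ((a (i + H.index) + a (i + H.index + 1) : G) : G ⧸ H) = (a i + a (i + 1) : G)
  rw [ha.periodic i, add_right_comm, ha.periodic (i + 1)]

theorem exists_eq_add_succ (ha : IsHarmoniousTransversal H a) (j : ℕ) :
    ∃ i, a i = a j + a (j + 1) := by
  obtain ⟨i, hi⟩ := ha.surjective (a j + a (j + 1) : G)
  obtain ⟨j', hj'⟩ := ha.exists_add_succ_eq i
  have hmod : j' ≡ j [MOD H.index] :=
    ha.modEq_of_mk_add_succ_eq ((congrArg QuotientAddGroup.mk hj').trans hi)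
  exact ⟨i, by rw [← hj', ha.eq_of_modEq hmod, ha.eq_of_modEq (hmod.add_right 1)]⟩

theorem eq_zero_of_mem (ha : IsHarmoniousTransversal H a) (hi : a i ∈ H) : a i = 0 := by
  have hmk : ((a i + a (i + 1) : G) : G ⧸ H) = a (i + 1) := by
    rw [QuotientAddGroup.mk_add, (QuotientAddGroup.eq_zero_iff _).2 hi, zero_add]
  obtain ⟨j, hj⟩ := ha.exists_add_succ_eq (i + 1)
  have hmod : j ≡ i [MOD H.index] :=
    ha.modEq_of_mk_add_succ_eq ((congrArg QuotientAddGroup.mk hj).trans hmk.symm)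
  rwa [ha.eq_of_modEq hmod, ha.eq_of_modEq (hmod.add_right 1), add_eq_right] at hj

end IsHarmoniousTransversal

section ClosedWeb

variable {m n : ℕ}

/-- The neighbor of a vertex of the prism on its path to the center of the web. -/
def towardsCenter : Fin m × Fin n → Option (Fin m × Fin n)
  | (j, i) => if (j : ℕ) = 0 then none else some (⟨j - 1, by omega⟩, i)

variable [NeZero n]

/-- A parametrization of the edges of the closed web: at each vertex of the prism start an edge
along its cycle and an edge towards the center. -/
def webEdge : (Fin m × Fin n) ⊕ (Fin m × Fin n) → Sym2 (Option (Fin m × Fin n))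
  | .inl p => s(some p, some (p.1, p.2 + 1))
  | .inr p => s(some p, towardsCenter p)

theorem cycleGraph_adj_iff_eq_add_one (hn : 2 ≤ n) {i i' : Fin n} :
    (SimpleGraph.cycleGraph n).Adj i i' ↔ i' = i + 1 ∨ i = i' + 1 := by
  have h1 : ∀ x y : Fin n, (x - y).val = 1 ↔ x = y + 1 := fun x y => by
    rw [← sub_eq_iff_eq_add', Fin.ext_iff, Fin.val_one', Nat.mod_eq_of_lt hn]
  rw [SimpleGraph.cycleGraph_adj', h1, h1, or_comm]

theorem range_webEdge (hn : 2 ≤ n) :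
    Set.range (webEdge (m := m) (n := n)) = (closedWeb m n).edgeSet := by
  ext e
  constructor
  · rintro ⟨⟨j, i⟩ | ⟨j, i⟩, rfl⟩
    · exact Or.inr ⟨(cycleGraph_adj_iff_eq_add_one hn).2 (Or.inl rfl), rfl⟩
    · rcases j with ⟨_ | j, hj⟩
      · exact rfl
      · exact Or.inl ⟨SimpleGraph.pathGraph_adj.2 (Or.inr rfl), rfl⟩
  · induction e with
    | _ x y =>
    have hcenter : ∀ p : Fin m × Fin n, (p.1 : ℕ) = 0 → webEdge (.inr p) = s(some p, none) :=
      fun p hp => by simp [webEdge, towardsCenter, hp]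
    have hpath : ∀ (j j' : Fin m) (i : Fin n), (j : ℕ) + 1 = j' →
        webEdge (.inr (j', i)) = s(some (j', i), some (j, i)) := fun j j' i h => by
      simp [webEdge, towardsCenter, ← h]
    intro (h : (closedWeb m n).Adj x y)
    match x, y, h with
    | none, some p, h => exact ⟨.inr p, (hcenter p h).trans Sym2.eq_swap⟩
    | some p, none, h => exact ⟨.inr p, hcenter p h⟩
    | some (j, i), some (j', i'), h =>
      rcases h with ⟨h, rfl : i = i'⟩ | ⟨h, rfl : j = j'⟩
      · rcases SimpleGraph.pathGraph_adj.1 h with h | h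
        · exact ⟨.inr (j', i), (hpath j j' i h).trans Sym2.eq_swap⟩
        · exact ⟨.inr (j, i), hpath j' j i h⟩
      · rcases (cycleGraph_adj_iff_eq_add_one hn).1 h with rfl | rfl
        · exact ⟨.inl (j, i), rfl⟩
        · exact ⟨.inl (j, i'), Sym2.eq_swap⟩

variable {G : Type*} [AddCommGroup G]

/-- The labeling of the closed web by the multiples of `h` along the paths to the center, and by
translates of the sequence `a`, shifted by one from each cycle to the next, along the cycles. -/
def webLabel (a : ℕ → G) (h : G) : Option (Fin m × Fin n) → G
  | none => -h
  | some (j, i) => a (j + i) + (j : ℕ) • h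

theorem inducedLabel_webLabel_inl {a : ℕ → G} (hper : Function.Periodic a n) (h : G) (j : Fin m)
    (i : Fin n) : inducedLabel (webLabel a h) (webEdge (.inl (j, i))) =
      a (j + i) + a (j + i + 1) + (2 * j : ℕ) • h := by
  have hmod : (j + (i + 1 : Fin n)) ≡ j + i + 1 [MOD n] := by
    simpa only [Fin.val_add, Fin.val_one', Nat.add_mod_mod, Nat.mod_add_mod, add_assoc] using
      (Nat.mod_modEq (i + 1) n).add_left j
  have : a (j + (i + 1 : Fin n)) = a (j + i + 1) :=
    eq_of_periodic_of_modEq hper hmod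
  change a (j + i) + (j : ℕ) • h + (a (j + (i + 1 : Fin n)) + (j : ℕ) • h) = _
  rw [this, two_mul, add_nsmul]
  abel

theorem inducedLabel_webLabel_inr_zero (a : ℕ → G) (h : G) {j : Fin m} (hj : (j : ℕ) = 0)
    (i : Fin n) : inducedLabel (webLabel a h) (webEdge (.inr (j, i))) = a i - h := by
  simp [webEdge, towardsCenter, inducedLabel, webLabel, hj, sub_eq_add_neg]

theorem inducedLabel_webLabel_inr_succ (a : ℕ → G) (h : G) {j : ℕ} (hj : j + 1 < m)
    (i : Fin n) : inducedLabel (webLabel a h) (webEdge (.inr (⟨j + 1, hj⟩, i))) =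
      a (j + i) + a (j + i + 1) + (2 * j + 1 : ℕ) • h := by
  change a (j + 1 + i) + (j + 1) • h + (a (j + i) + j • h) = _
  rw [add_right_comm j 1 i, two_mul, add_nsmul, add_nsmul, add_nsmul]
  abel

theorem webLabel_injective {H : AddSubgroup G} [H.FiniteIndex] {a : ℕ → G} {h : G}
    (ha : IsHarmoniousTransversal H a) (hH : H.index = n) (hh : h ∈ H) (hm : m < addOrderOf h) :
    Function.Injective (webLabel a h : Option (Fin m × Fin n) → G) := by
  have hmk : ∀ (j : Fin m) (i : Fin n),
      ((a (j + i) + (j : ℕ) • h : G) : G ⧸ H) = a (j + i) := fun j i => by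
    rw [QuotientAddGroup.mk_add, (QuotientAddGroup.eq_zero_iff _).2 (H.nsmul_mem hh _), add_zero]
  have hnone : ∀ (j : Fin m) (i : Fin n), -h ≠ a (j + i) + (j : ℕ) • h := fun j i e => by
    have hmem : a (j + i) ∈ H := by
      rw [eq_sub_of_add_eq e.symm]
      exact H.sub_mem (H.neg_mem hh) (H.nsmul_mem hh _)
    rw [ha.eq_zero_of_mem hmem, zero_add, neg_eq_iff_add_eq_zero, ← succ_nsmul'] at e
    exact Nat.not_dvd_of_pos_of_lt j.val.succ_pos (by omega) (addOrderOf_dvd_iff_nsmul_eq_zero.2 e)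
  rintro (_ | ⟨j, i⟩) (_ | ⟨j', i'⟩) (e : _ = _)
  · rfl
  · exact absurd e (hnone j' i')
  · exact absurd e.symm (hnone j i)
  · have e : a (j + i) + (j : ℕ) • h = a (j' + i') + (j' : ℕ) • h := e
    have hmod : j + i ≡ j' + i' [MOD H.index] := ha.modEq_of_mk_eq (by rw [← hmk, e, hmk])
    rw [ha.eq_of_modEq hmod] at e
    have hj : (j : ℕ) = j' := nsmul_injOn_Iio_addOrderOf (j.2.trans hm) (j'.2.trans hm)
      (add_left_cancel e)
    have hi : (i : ℕ) ≡ i' [MOD n] := hH ▸ Nat.ModEq.add_left_cancel' _ (hj ▸ hmod)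
    rw [Fin.ext hj, Fin.ext (hi.eq_of_lt_of_lt i.2 i'.2)]

theorem webLabel_surjective [NeZero m] {a : ℕ → G} {h : G}
    (ha : IsHarmoniousTransversal (AddSubgroup.zmultiples h) a)
    (hindex : (AddSubgroup.zmultiples h).index = n) (hh : addOrderOf h = 2 * m) :
    Function.Surjective fun p : (Fin m × Fin n) ⊕ (Fin m × Fin n) =>
      inducedLabel (webLabel a h) (webEdge p) := by
  have : (AddSubgroup.zmultiples h).FiniteIndex := ⟨hindex ▸ NeZero.ne n⟩
  have hper : Function.Periodic a n := hindex ▸ ha.periodic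
  intro g
  obtain ⟨s, hs⟩ := ha.surjective_mk_add_succ g
  obtain ⟨e, he, rfl⟩ : ∃ e < 2 * m, a s + a (s + 1) + e • h = g := by
    classical
    have hfin : IsOfFinAddOrder h := addOrderOf_pos_iff.1 (hh ▸ Nat.mul_pos two_pos (NeZero.pos m))
    obtain ⟨e, he, heq⟩ := Finset.mem_image.1
      (hfin.mem_zmultiples_iff_mem_range_addOrderOf.1 (QuotientAddGroup.eq.1 hs))
    exact ⟨e, hh ▸ Finset.mem_range.1 he, by rw [heq, add_neg_cancel_left]⟩
  obtain ⟨j, rfl | rfl⟩ := e.even_or_odd'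
  · obtain ⟨i, hi, hi'⟩ := exists_fin_add_eq_of_periodic hper j s
    exact ⟨.inl (⟨j, by omega⟩, i), by
      simp only [inducedLabel_webLabel_inl hper, hi, hi']⟩
  · obtain hj | rfl : j + 1 < m ∨ j + 1 = m := by omega
    · obtain ⟨i, hi, hi'⟩ := exists_fin_add_eq_of_periodic hper j s
      exact ⟨.inr (⟨j + 1, hj⟩, i), by
        simp only [inducedLabel_webLabel_inr_succ, hi, hi']⟩
    · obtain ⟨s', hs'⟩ := ha.exists_eq_add_succ s
      obtain ⟨i, hi, -⟩ := exists_fin_add_eq_of_periodic hper 0 s'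
      have hlast : (2 * j + 1) • h = -h := by
        rw [eq_neg_iff_add_eq_zero, ← succ_nsmul, ← addOrderOf_dvd_iff_nsmul_eq_zero, hh, mul_add]
      rw [zero_add] at hi
      refine ⟨.inr (0, i), ?_⟩
      simp only [inducedLabel_webLabel_inr_zero _ _ (Fin.val_zero _), hi, hs', hlast,
        sub_eq_add_neg]

theorem IsHarmoniousTransversal.isHarmonious_closedWeb [NeZero m] {a : ℕ → G} {h : G}
    (ha : IsHarmoniousTransversal (AddSubgroup.zmultiples h) a) (hn : 2 ≤ n)
    (hindex : (AddSubgroup.zmultiples h).index = n) (hh : addOrderOf h = 2 * m) :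
    IsHarmonious (closedWeb m n) G := by
  have : (AddSubgroup.zmultiples h).FiniteIndex := ⟨hindex ▸ NeZero.ne n⟩
  have hm : 0 < m := Nat.pos_of_neZero m
  have hcard : Nat.card G = 2 * m * n := by
    rw [← (AddSubgroup.zmultiples h).card_mul_index, hindex, Nat.card_zmultiples, hh]
  have hsurj := webLabel_surjective ha hindex hh
  have : Finite G := Nat.finite_of_card_ne_zero (by rw [hcard]; positivity)
  have hinj := (hsurj.bijective_of_nat_card_le (by simp [hcard, two_mul, add_mul])).injective
  refine ⟨webLabel a h, webLabel_injective ha hindex (AddSubgroup.mem_zmultiples h) (by omega),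
    ?_, fun g => ?_⟩
  · rintro ⟨e, he⟩ ⟨e', he'⟩ hee'
    rw [← range_webEdge hn] at he he'
    obtain ⟨p, rfl⟩ := he
    obtain ⟨p', rfl⟩ := he'
    exact Subtype.ext (congrArg webEdge (hinj hee'))
  · obtain ⟨p, hp⟩ := hsurj g
    exact ⟨⟨webEdge p, range_webEdge hn ▸ Set.mem_range_self p⟩, hp⟩

end ClosedWeb

theorem IsHarmoniousTransversal.map {G G' : Type*} [AddCommGroup G] [AddCommGroup G']
    {H : AddSubgroup G} {H' : AddSubgroup G'} {a : ℕ → G} (ha : IsHarmoniousTransversal H a)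
    (φ : G →+ G') (hφ : ∀ y, ∃ x, φ x - y ∈ H') (hH : H.map φ ≤ H') (hindex : H'.index = H.index) :
    IsHarmoniousTransversal H' (φ ∘ a) where
  periodic := hindex ▸ ha.periodic.comp φ
  surjective y := by
    obtain ⟨y, rfl⟩ := QuotientAddGroup.mk_surjective y
    obtain ⟨x, hx⟩ := hφ y
    obtain ⟨i, hi⟩ := ha.surjective x
    refine ⟨i, QuotientAddGroup.eq.2 ?_⟩
    have hix : φ (-a i + x) ∈ H' := hH ⟨_, QuotientAddGroup.eq.1 hi, rfl⟩
    rw [map_add, map_neg] at hix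
    convert H'.sub_mem hix hx using 1
    simp only [Function.comp_apply]
    abel
  exists_add_succ_eq i := by
    obtain ⟨j, hj⟩ := ha.exists_add_succ_eq i
    exact ⟨j, (map_add φ _ _).symm.trans (congrArg φ hj)⟩

/-- There is a walk in `G` with `n` steps from `u` to `v` that visits every element of `V` and such
that every element of `S` is the sum of two consecutive elements of the walk. -/
def CoveringWalk {G : Type*} [Add G] (u v : G) (V S : Set G) (n : ℕ) : Prop :=
  ∃ w : ℕ → G, w 0 = u ∧ w n = v ∧ (∀ y ∈ V, ∃ i ≤ n, w i = y) ∧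
    ∀ s ∈ S, ∃ i < n, w i + w (i + 1) = s

namespace CoveringWalk

variable {G : Type*}

theorem mono [Add G] {u v : G} {V S V' S' : Set G} {n n' : ℕ} (h : CoveringWalk u v V S n)
    (hV : V' ⊆ V) (hS : S' ⊆ S) (hn : n = n') : CoveringWalk u v V' S' n' := by
  obtain ⟨w, h0, hn', hwV, hwS⟩ := h
  exact hn ▸ ⟨w, h0, hn', fun y hy => hwV y (hV hy), fun s hs => hwS s (hS hs)⟩

theorem of_seq [Add G] (w : ℕ → G) (n : ℕ) : CoveringWalk (w 0) (w n) {y | ∃ i ≤ n, w i = y}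
    {s | ∃ i < n, w i + w (i + 1) = s} n :=
  ⟨w, rfl, rfl, fun _ h => h, fun _ h => h⟩

theorem refl [Add G] (u : G) : CoveringWalk u u {u} ∅ 0 :=
  ⟨fun _ => u, rfl, rfl, fun _ hy => ⟨0, le_rfl, hy.symm⟩, by simp⟩

theorem trans [Add G] {u v x : G} {V S V' S' : Set G} {n n' : ℕ}
    (h : CoveringWalk u v V S n) (h' : CoveringWalk v x V' S' n') :
    CoveringWalk u x (V ∪ V') (S ∪ S') (n + n') := by
  obtain ⟨w, h0, hn, hV, hS⟩ := h
  obtain ⟨w', h0', hn', hV', hS'⟩ := h'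
  let W : ℕ → G := fun i => if i ≤ n then w i else w' (i - n)
  have hW : ∀ i ≤ n, W i = w i := fun i hi => if_pos hi
  have hW' : ∀ i, W (n + i) = w' i := fun i => by
    rcases i.eq_zero_or_pos with rfl | hi
    · exact (hW n le_rfl).trans (hn.trans h0'.symm)
    · exact (if_neg (by omega)).trans (congrArg w' (by omega))
  refine ⟨W, (hW 0 n.zero_le).trans h0, (hW' n').trans hn', ?_, ?_⟩
  · rintro y (hy | hy)
    · obtain ⟨i, hi, rfl⟩ := hV y hy
      exact ⟨i, by omega, hW i hi⟩
    · obtain ⟨i, hi, rfl⟩ := hV' y hy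
      exact ⟨n + i, by omega, hW' i⟩
  · rintro s (hs | hs)
    · obtain ⟨i, hi, rfl⟩ := hS s hs
      exact ⟨i, by omega, by rw [hW i hi.le, hW (i + 1) hi]⟩
    · obtain ⟨i, hi, rfl⟩ := hS' s hs
      exact ⟨n + i, by omega, by rw [hW' i, add_assoc n, hW']⟩

theorem edge [Add G] (u v : G) : CoveringWalk u v {u, v} {u + v} 1 := by
  refine ⟨fun i => if i = 0 then u else v, rfl, rfl, ?_, ?_⟩
  · rintro _ (rfl | rfl)
    · exact ⟨0, by omega, rfl⟩
    · exact ⟨1, by omega, rfl⟩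
  · rintro _ rfl
    exact ⟨0, by omega, rfl⟩

theorem append [Add G] {u v u' v' : G} {V S V' S' : Set G} {n n' : ℕ}
    (h : CoveringWalk u v V S n) (h' : CoveringWalk u' v' V' S' n') :
    CoveringWalk u v' (V ∪ V') (insert (v + u') (S ∪ S')) (n + 1 + n') :=
  ((h.trans (edge v u')).trans h').mono (Set.union_subset_union_left _ Set.subset_union_left)
    (by rw [Set.union_singleton, Set.insert_union]) rfl

theorem reverse [AddCommMagma G] {u v : G} {V S : Set G} {n : ℕ} (h : CoveringWalk u v V S n) :
    CoveringWalk v u V S n := by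
  obtain ⟨w, h0, hn, hV, hS⟩ := h
  refine ⟨fun i => w (n - i), by simpa using hn, by simpa using h0, fun y hy => ?_, fun s hs => ?_⟩
  · obtain ⟨i, hi, rfl⟩ := hV y hy
    exact ⟨n - i, n.sub_le i, congrArg w (Nat.sub_sub_self hi)⟩
  · obtain ⟨i, hi, rfl⟩ := hS s hs
    exact ⟨n - (i + 1), by omega, (add_comm _ _).trans
      (congrArg₂ _ (congrArg w (by omega)) (congrArg w (by omega)))⟩

theorem cons [Add G] {u' v : G} {V S : Set G} {n : ℕ} (u : G) (h : CoveringWalk u' v V S n) :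
    CoveringWalk u v (insert u V) (insert (u + u') S) (n + 1) :=
  ((refl u).append h).mono (Set.insert_eq u V).le (by rw [Set.empty_union]) (by omega)

theorem snoc [Add G] {u v : G} {V S : Set G} {n : ℕ} (h : CoveringWalk u v V S n) (v' : G) :
    CoveringWalk u v' (insert v' V) (insert (v + v') S) (n + 1) :=
  (h.append (refl v')).mono (by rw [Set.union_singleton]) (by rw [Set.union_empty]) rfl

theorem chain [Add G] {u : ℕ → G} {V S : ℕ → Set G} {n : ℕ}
    (h : ∀ i, CoveringWalk (u i) (u (i + 1)) (V i) (S i) n) (r : ℕ) :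
    CoveringWalk (u 0) (u r) (insert (u r) {y | ∃ i < r, y ∈ V i}) {s | ∃ i < r, s ∈ S i}
      (n * r) := by
  induction r with
  | zero => exact (refl _).mono (by simp) (by simp) rfl
  | succ r ih =>
    refine ((ih.trans (h r)).trans (refl _)).mono ?_ ?_ rfl
    · rintro y (rfl | ⟨i, hi, hy⟩)
      · exact Or.inr rfl
      · rcases (Nat.lt_succ_iff_lt_or_eq.1 hi) with hi | rfl
        · exact Or.inl (Or.inl (Or.inr ⟨i, hi, hy⟩))
        · exact Or.inl (Or.inr hy)
    · rintro s ⟨i, hi, hs⟩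
      rcases (Nat.lt_succ_iff_lt_or_eq.1 hi) with hi | rfl
      · exact Or.inl (Or.inl ⟨i, hi, hs⟩)
      · exact Or.inl (Or.inr hs)

theorem exists_isHarmoniousTransversal [AddCommGroup G] {H : AddSubgroup G} [H.FiniteIndex] {u : G}
    {V S : Set G} (h : CoveringWalk u u V S H.index) (hV : ∀ x, ∃ y ∈ V, y - x ∈ H) (hVS : V ⊆ S) :
    ∃ a, IsHarmoniousTransversal H a := by
  obtain ⟨w, h0, hn, hwV, hwS⟩ := h
  let a : ℕ → G := fun i => w (i % H.index)
  have hper : Function.Periodic a H.index := fun i => congrArg w (Nat.add_mod_right i _)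
  have hle : ∀ i ≤ H.index, a i = w i := fun i hi => by
    rcases hi.lt_or_eq with hi | rfl
    · exact congrArg w (Nat.mod_eq_of_lt hi)
    · exact (congrArg w (Nat.mod_self _)).trans (h0.trans hn.symm)
  have hcover : ∀ x, ∃ i, a i ∈ V ∧ (a i : G ⧸ H) = x := fun x => by
    obtain ⟨x, rfl⟩ := QuotientAddGroup.mk_surjective x
    obtain ⟨y, hy, hyx⟩ := hV x
    obtain ⟨i, hi, rfl⟩ := hwV y hy
    rw [← hle i hi] at hy hyx
    refine ⟨i, hy, QuotientAddGroup.eq.2 ?_⟩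
    rw [neg_add_eq_sub, ← neg_sub]
    exact H.neg_mem hyx
  have hsurj : Function.Surjective fun i => (a i : G ⧸ H) := fun x =>
    (hcover x).imp fun _ => And.right
  refine ⟨a, hper, hsurj, fun i => ?_⟩
  obtain ⟨i', hi', hmk⟩ := hcover (a i)
  have hii' : a i' = a i :=
    eq_of_periodic_of_modEq hper (modEq_of_periodic_of_surjective (hper.comp _) hsurj hmk)
  obtain ⟨j, hj, hjs⟩ := hwS _ (hVS (hii' ▸ hi'))
  exact ⟨j, by rw [hle j hj.le, hle (j + 1) hj, hjs]⟩

end CoveringWalk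

/-- Every closed sequence of length `n` can be woven along `θ`: some closed walk visits all
translates of its terms by the image of `θ`, with all translates of the sums of two cyclically
consecutive terms among its own sums, in as many steps as there are pairs of a term and an element
of `A`. This is what lifts harmonious transversals from a quotient by the image of `θ`. -/
def Weaves {A G : Type*} [AddCommGroup A] [AddCommGroup G] (θ : A →+ G) (n : ℕ) : Prop :=
  ∀ a : ℕ → G, Function.Periodic a n → ∃ u, CoveringWalk u u {y | ∃ i c, a i + θ c = y}
    {s | ∃ i c, a i + a (i + 1) + θ c = s} (n * Nat.card A)

section Weaves

variable {A G : Type*} [AddCommGroup A] [AddCommGroup G]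

theorem Weaves.exists_isHarmoniousTransversal {G' : Type*} [AddCommGroup G'] {θ : A →+ G} {n : ℕ}
    (hθ : Weaves θ n) {φ : G →+ G'} (hφ : Function.Surjective φ) (hker : φ.ker = θ.range)
    {H : AddSubgroup G} [H.FiniteIndex] (hmap : (H.map φ).index = n)
    (hH : H.index = n * Nat.card A) (h : ∃ a, IsHarmoniousTransversal (H.map φ) a) :
    ∃ a, IsHarmoniousTransversal H a := by
  obtain ⟨a, ha⟩ := h
  have hlift : ∀ y, φ (Function.surjInv hφ y) = y := Function.surjInv_eq hφ
  have hrange : ∀ {x}, φ x = 0 → ∃ c, θ c = x := fun hx =>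
    (hker ▸ AddMonoidHom.mem_ker.2 hx : _ ∈ θ.range)
  obtain ⟨u, hu⟩ := hθ (Function.surjInv hφ ∘ a) (hmap ▸ ha.periodic.comp _)
  refine (hH ▸ hu).exists_isHarmoniousTransversal (fun x => ?_) ?_
  · obtain ⟨i, hi⟩ := ha.surjective (φ x)
    obtain ⟨h, hh, hφh⟩ := QuotientAddGroup.eq.1 hi
    obtain ⟨c, hc⟩ := hrange (x := x - h - Function.surjInv hφ (a i)) (by
      rw [map_sub, map_sub, hφh, hlift]
      abel)
    refine ⟨_, ⟨i, c, rfl⟩, ?_⟩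
    rw [hc]
    convert H.neg_mem hh using 1
    simp only [Function.comp_apply]
    abel
  · rintro _ ⟨i, c, rfl⟩
    obtain ⟨j, hj⟩ := ha.exists_add_succ_eq i
    obtain ⟨d, hd⟩ := hrange (x := Function.surjInv hφ (a i) - (Function.surjInv hφ (a j) +
        Function.surjInv hφ (a (j + 1)))) (by
      rw [map_sub, map_add, hlift, hlift, hlift, hj, sub_self])
    refine ⟨j, d + c, ?_⟩
    rw [map_add, hd]
    simp only [Function.comp_apply]
    abel

theorem add_map_add_add_map (θ : A →+ G) (x y : G) (c d : A) :
    x + θ c + (y + θ d) = x + y + θ (c + d) := by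
  rw [map_add, add_add_add_comm]

theorem weaves_of_forall_lt {θ : A →+ G} {n : ℕ} (hn : n ≠ 0)
    (h : ∀ a : ℕ → G, Function.Periodic a n → ∃ u, CoveringWalk u u
      {y | ∃ i < n, ∃ c, a i + θ c = y} {s | ∃ i < n, ∃ c, a i + a (i + 1) + θ c = s}
      (n * Nat.card A)) : Weaves θ n := fun a ha => by
  have hmod : ∀ i, i % n < n := fun i => Nat.mod_lt i (Nat.pos_of_ne_zero hn)
  have hsucc : ∀ i, a (i % n + 1) = a (i + 1) := fun i =>
    eq_of_periodic_of_modEq ha ((Nat.mod_modEq i n).add_right 1)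
  obtain ⟨u, hu⟩ := h a ha
  refine ⟨u, hu.mono ?_ ?_ rfl⟩
  · rintro _ ⟨i, c, rfl⟩
    exact ⟨i % n, hmod i, c, by rw [ha.map_mod_nat]⟩
  · rintro _ ⟨i, c, rfl⟩
    exact ⟨i % n, hmod i, c, by rw [ha.map_mod_nat, hsucc]⟩

theorem weaves_zmod_of_odd {p n : ℕ} (hp : Odd p) (hn : n ≠ 0) (θ : ZMod p →+ G) :
    Weaves θ n := by
  have : NeZero p := ⟨hp.pos.ne'⟩
  refine weaves_of_forall_lt hn fun a ha => ⟨a 0, ?_⟩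
  let w : ℕ → G := fun i => a i + θ (i / n : ℕ)
  have hw : ∀ i c, i < n → w (n * c + i) = a i + θ (c : ℕ) := fun i c hi => by
    have hdiv : (n * c + i) / n = c := by
      rw [Nat.mul_add_div (Nat.pos_of_ne_zero hn), Nat.div_eq_of_lt hi, add_zero]
    change a (n * c + i) + θ ((n * c + i) / n : ℕ) = _
    rw [hdiv, eq_of_periodic_of_modEq ha (Nat.modulus_mul_add_modEq_iff.2 rfl)]
  have hw0 : ∀ c, w (n * c) = a 0 + θ (c : ℕ) := fun c => hw 0 c (Nat.pos_of_ne_zero hn)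
  have hlt : ∀ i (c : ZMod p), i < n → n * c.val + i < n * p := fun i c hi =>
    (Nat.add_lt_add_left hi _).trans_le (Nat.mul_le_mul_left n (ZMod.val_lt c))
  have hhalf : ∀ c : ZMod p, ∃ d : ZMod p, d + d = c := fun c => by
    obtain ⟨k, rfl⟩ := hp
    refine ⟨(k + 1) * c, ?_⟩
    have h2k : ((2 * k + 1 : ℕ) : ZMod (2 * k + 1)) = 0 := ZMod.natCast_self _
    push_cast at h2k
    linear_combination c * h2k
  have hwalk : CoveringWalk (w (n * 0)) (w (n * p)) _ _ (n * p) := CoveringWalk.of_seq w (n * p)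
  rw [hw0, hw0, Nat.cast_zero, ZMod.natCast_self, map_zero, add_zero] at hwalk
  refine hwalk.mono ?_ ?_ (by rw [Nat.card_zmod])
  · rintro _ ⟨i, hi, c, rfl⟩
    exact ⟨_, (hlt i c hi).le, by rw [hw i _ hi, ZMod.natCast_zmod_val]⟩
  · rintro _ ⟨i, hi, c, rfl⟩
    obtain hi' | rfl : i + 1 < n ∨ n = i + 1 := by omega
    · obtain ⟨d, rfl⟩ := hhalf c
      refine ⟨_, hlt i d hi, ?_⟩
      rw [hw i _ hi, add_assoc (n * _), hw _ _ hi', add_map_add_add_map, ZMod.natCast_zmod_val]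
    · obtain ⟨d, hd⟩ := hhalf (c - 1)
      refine ⟨_, hlt i d hi, ?_⟩
      rw [hw i _ hi, add_assoc (_ * _), ← Nat.mul_succ, hw0, add_map_add_add_map, Nat.cast_succ,
        ZMod.natCast_zmod_val, ← add_assoc d, hd, sub_add_cancel, ha.eq]

theorem zmod_four_cases (c : ZMod 4) : c = 0 ∨ c = 1 ∨ c = 2 ∨ c = 3 := by
  revert c
  decide

theorem coveringWalk_zmod_four_strand (θ : ZMod 4 →+ G) (a : ℕ → G) (r : ℕ) :
    CoveringWalk (a (2 * 0) + θ 1) (a (2 * r) + θ 1)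
      (insert (a (2 * r) + θ 1) ({y | ∃ i < r, a (2 * i) + θ 1 = y ∨ a (2 * i) + θ 2 = y ∨
        a (2 * i + 2) + θ 0 = y} ∪ {y | ∃ i < r, ∃ c ≠ 1, a (2 * i + 1) + θ c = y}))
      {s | ∃ i < 2 * r, ∃ c ≠ 0, a i + a (i + 1) + θ c = s} (6 * r) := by
  refine (CoveringWalk.chain (u := fun i => a (2 * i) + θ 1) (fun i =>
    ((((((CoveringWalk.refl _).snoc (a (2 * i + 1) + θ 2)).snoc (a (2 * i + 2) + θ 0)).snoc
      (a (2 * i + 1) + θ 3)).snoc (a (2 * i) + θ 2)).snoc (a (2 * i + 1) + θ 0)).snoc _) r).mono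
      (Set.insert_subset_insert ?_) ?_ rfl
  · rintro _ (⟨i, hi, rfl | rfl | rfl⟩ | ⟨i, hi, c, hc, rfl⟩) <;> refine ⟨i, hi, ?_⟩
    iterate 3 simp
    rcases zmod_four_cases c with rfl | rfl | rfl | rfl <;> simp at hc ⊢
  · rintro _ ⟨i, hi, c, hc, rfl⟩
    obtain ⟨i, rfl | rfl⟩ := i.even_or_odd' <;> refine ⟨i, by omega, ?_⟩ <;>
      simp only [Set.mem_insert_iff, Set.mem_empty_iff_false, or_false, add_map_add_add_map,
        mul_add, mul_one, add_comm (a (_ + 1)) (a (2 * i)),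
        add_comm (a (_ + 2)) (a (2 * i + 1))] <;>
      rcases zmod_four_cases c with rfl | rfl | rfl | rfl <;> reduce_mod_char <;>
      simp at hc ⊢

theorem coveringWalk_zmod_four_thread (θ : ZMod 4 →+ G) (a : ℕ → G) (r : ℕ) :
    CoveringWalk (a (2 * 0) + θ 3) (a (2 * r) + θ 3)
      ({y | ∃ i ≤ r, a (2 * i) + θ 3 = y} ∪ {y | ∃ i < r, a (2 * i + 1) + θ 1 = y})
      {s | ∃ i < 2 * r, a i + a (i + 1) + θ 0 = s} (2 * r) := by
  refine (CoveringWalk.chain (u := fun i => a (2 * i) + θ 3) (fun i =>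
    ((CoveringWalk.refl _).snoc (a (2 * i + 1) + θ 1)).snoc _) r).mono ?_ ?_ rfl
  · rintro _ (⟨i, hi, rfl⟩ | ⟨i, hi, rfl⟩)
    · rcases hi.lt_or_eq with hi | rfl
      · exact Or.inr ⟨i, hi, by simp⟩
      · exact Or.inl rfl
    · exact Or.inr ⟨i, hi, by simp⟩
  · rintro _ ⟨i, hi, rfl⟩
    obtain ⟨i, rfl | rfl⟩ := i.even_or_odd' <;> refine ⟨i, by omega, ?_⟩ <;>
      simp only [Set.mem_insert_iff, Set.mem_empty_iff_false, or_false, add_map_add_add_map,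
        mul_add, mul_one] <;> reduce_mod_char <;> simp

theorem weaves_zmod_four {n : ℕ} (hn : Even n) (hn0 : n ≠ 0) (θ : ZMod 4 →+ G) :
    Weaves θ n := by
  obtain ⟨r, rfl⟩ : ∃ r, n = 2 * r + 2 := by
    obtain ⟨k, rfl⟩ := hn
    exact ⟨k - 1, by omega⟩
  refine weaves_of_forall_lt hn0 fun a ha => ⟨a (2 * 0) + θ 1, ?_⟩
  have ha0 : a (2 * r + 1 + 1) = a (2 * 0) := (congrArg a (by omega)).trans (ha 0)
  refine (((((((((coveringWalk_zmod_four_strand θ a r).snoc (a (2 * r + 1) + θ 0)).snoc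
    (a (2 * 0) + θ 0)).snoc (a (2 * r + 1) + θ 3)).append
    (coveringWalk_zmod_four_thread θ a r).reverse).snoc (a (2 * r + 1) + θ 2)).snoc
    (a (2 * r) + θ 2)).snoc (a (2 * r + 1) + θ 1)).snoc (a (2 * 0) + θ 1)).mono ?_ ?_
      (by rw [Nat.card_zmod]; ring)
  · rintro _ ⟨i, hi, c, rfl⟩
    simp only [Set.mem_insert_iff, Set.mem_union, Set.mem_ofPred_eq]
    obtain ⟨j, rfl | rfl⟩ := i.even_or_odd' <;>
      rcases (show j < r ∨ j = r by omega) with hj | rfl <;>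
      rcases zmod_four_cases c with rfl | rfl | rfl | rfl <;> try grind
    all_goals rcases j with _ | j <;> grind
  · rintro _ ⟨i, hi, c, rfl⟩
    simp only [Set.mem_insert_iff, Set.mem_union, Set.mem_ofPred_eq, add_map_add_add_map]
    obtain hi | rfl | rfl : i < 2 * r ∨ i = 2 * r ∨ i = 2 * r + 1 := by omega
    · have : c = 0 ∨ c ≠ 0 := em _
      grind
    all_goals
      simp only [ha0, add_comm (a (2 * r + 1)) (a (2 * r)), add_comm (a (2 * 0)) (a (2 * r + 1))]
      rcases zmod_four_cases c with rfl | rfl | rfl | rfl <;> reduce_mod_char <;> simp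

theorem coveringWalk_add_map (θ : A →+ G) (a : ℕ → G) (ρ : ℕ → A) (k : ℕ) :
    CoveringWalk (a 0 + θ (ρ 0)) (a k + θ (ρ k)) {y | ∃ i ≤ k, a i + θ (ρ i) = y}
      {s | ∃ i < k, a i + a (i + 1) + θ (ρ i + ρ (i + 1)) = s} k := by
  simpa only [add_map_add_add_map] using CoveringWalk.of_seq (fun i => a i + θ (ρ i)) k

theorem zmod_two_prod_zmod_two_cases (c : ZMod 2 × ZMod 2) :
    c = (0, 0) ∨ c = (0, 1) ∨ c = (1, 0) ∨ c = (1, 1) := by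
  revert c
  decide

theorem exists_rows_zmod_two_prod_zmod_two : ∃ ρ : ZMod 2 × ZMod 2 → ℕ → ZMod 2 × ZMod 2,
    (∀ x, ρ x 0 = x) ∧ (∀ x, ∀ i ≠ 0, ρ x (2 * i) = (x.1 + x.2, x.1)) ∧
      (∀ i c, ∃ x, ρ x i = c) ∧ ∀ i c, ∃ x, ρ x i + ρ x (i + 1) = c := by
  let rot : ZMod 2 × ZMod 2 → ZMod 2 × ZMod 2 := fun x => (x.2, x.1 + x.2)
  let rot' : ZMod 2 × ZMod 2 → ZMod 2 × ZMod 2 := fun x => (x.1 + x.2, x.1)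
  let ρ : ZMod 2 × ZMod 2 → ℕ → ZMod 2 × ZMod 2 := fun x i =>
    if i = 0 then x else if Even i then rot' x else rot x
  refine ⟨ρ, fun _ => rfl, fun x i hi => by simp [ρ, hi, rot'], fun i c => ?_, fun i c => ?_⟩
  · have hrot : ∀ c, ∃ x, rot x = c := by decide
    have hrot' : ∀ c, ∃ x, rot' x = c := by decide
    by_cases hi : i = 0 <;> by_cases hi' : Even i <;> simp [ρ, hi, hi', hrot, hrot']
  · have hfirst : ∀ c, ∃ x, x + rot x = c := by decide
    have hlater : ∀ c, ∃ x, rot x + rot' x = c := by decide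
    by_cases hi : i = 0 <;> by_cases hi' : Even i <;>
      simp [ρ, hi, hi', hfirst, hlater, Nat.even_add_one, add_comm (rot' _)]

theorem weaves_zmod_two_prod_zmod_two {n : ℕ} (hn : Even n) (hn4 : 4 ≤ n)
    (θ : ZMod 2 × ZMod 2 →+ G) : Weaves θ n := by
  obtain ⟨r, rfl⟩ : ∃ r, n = 2 * r + 2 := by
    obtain ⟨k, rfl⟩ := hn
    exact ⟨k - 1, by omega⟩
  obtain ⟨ρ, hρ0, hρr, hρ, hρ_add⟩ := exists_rows_zmod_two_prod_zmod_two
  replace hρr := fun x => hρr x r (by omega)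
  refine weaves_of_forall_lt (by omega) fun a ha => ⟨a 0 + θ (ρ (0, 0) 0), ?_⟩
  have ha0 : a (2 * r + 1 + 1) = a 0 := (congrArg a (by omega)).trans (ha 0)
  have hwalk := fun x => coveringWalk_add_map θ a (ρ x) (2 * r)
  refine ((((((((hwalk (0, 0)).snoc (a (2 * r + 1) + θ (0, 0))).append
    (hwalk (0, 1)).reverse).snoc (a (2 * r + 1) + θ (0, 1))).append
    (hwalk (1, 1))).snoc (a (2 * r + 1) + θ (1, 0))).append
    (hwalk (1, 0)).reverse).snoc (a (2 * r + 1) + θ (1, 1))).snoc _ |>.mono ?_ ?_ ?_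
  · rintro _ ⟨i, hi, c, rfl⟩
    simp only [Set.mem_insert_iff, Set.mem_union, Set.mem_ofPred_eq]
    obtain hi | rfl : i ≤ 2 * r ∨ i = 2 * r + 1 := by omega
    · obtain ⟨x, rfl⟩ := hρ i c
      rcases zmod_two_prod_zmod_two_cases x with rfl | rfl | rfl | rfl <;> grind
    · rcases zmod_two_prod_zmod_two_cases c with rfl | rfl | rfl | rfl <;> simp
  · rintro _ ⟨i, hi, c, rfl⟩
    simp only [Set.mem_insert_iff, Set.mem_union, Set.mem_ofPred_eq, add_map_add_add_map, hρ0, hρr]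
    obtain hi | rfl | rfl : i < 2 * r ∨ i = 2 * r ∨ i = 2 * r + 1 := by omega
    · obtain ⟨x, rfl⟩ := hρ_add i c
      rcases zmod_two_prod_zmod_two_cases x with rfl | rfl | rfl | rfl <;> grind
    all_goals
      simp only [ha0, add_comm (a (2 * r + 1)) (a (2 * r)), add_comm (a 0) (a (2 * r + 1)),
        Prod.mk_add_mk]
      rcases zmod_two_prod_zmod_two_cases c with rfl | rfl | rfl | rfl <;>
        reduce_mod_char <;> simp
  · simp only [Nat.card_prod, Nat.card_zmod]
    ring

end Weaves

/-- The subgroup generated by `(n, 0)` has a harmonious transversal in `ℤ × D`. The quotient is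
`ZMod n × D`, but the sums of consecutive terms are compared in `ℤ × D`, so that the transversal
can be mapped to a group in which the image of `(n, 0)` is a nonzero element. -/
def HasHarmoniousTransversal (n : ℕ) (D : Type*) [AddCommGroup D] : Prop :=
  ∃ a, IsHarmoniousTransversal (AddSubgroup.zmultiples ((n : ℤ), (0 : D))) a

section Box

variable {A : Type*} [AddCommGroup A]

/-- A set of representatives of the cosets of `(2 * k, 0)` in `ℤ × A` which is as central as
possible: in the row `b` its first coordinate ranges over `(-k, k]` if `B b` holds, and over
`[-k, k)` otherwise. -/
def centralBox (k : ℕ) (B : A → Prop) : Set (ℤ × A) :=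
  {z | -k < z.1 ∧ z.1 < k ∨ z.1 = k ∧ B z.2 ∨ z.1 = -k ∧ ¬B z.2}

theorem index_zmultiples_prodMk_zero (n : ℕ) (A : Type*) [AddCommGroup A] :
    (AddSubgroup.zmultiples ((n : ℤ), (0 : A))).index = n * Nat.card A := by
  have : AddSubgroup.zmultiples ((n : ℤ), (0 : A)) = (AddSubgroup.zmultiples (n : ℤ)).prod ⊥ := by
    ext ⟨x, y⟩
    simp [AddSubgroup.mem_prod, AddSubgroup.mem_zmultiples_iff, eq_comm]
  rw [this, AddSubgroup.index_prod, Int.index_zmultiples, AddSubgroup.index_bot, Int.natAbs_natCast]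

theorem exists_mem_centralBox {k : ℕ} (hk : k ≠ 0) (B : A → Prop) (x : ℤ × A) :
    ∃ y ∈ centralBox k B, y - x ∈ AddSubgroup.zmultiples (((2 * k : ℕ) : ℤ), (0 : A)) := by
  obtain ⟨x, b⟩ := x
  have hk' : (0 : ℤ) < 2 * k := by omega
  suffices ∃ q : ℤ, (x + q * (2 * k), b) ∈ centralBox k B by
    obtain ⟨q, hq⟩ := this
    exact ⟨_, hq, AddSubgroup.mem_zmultiples_iff.2 ⟨q, by simp⟩⟩
  simp only [centralBox, Set.mem_ofPred_eq]
  by_cases hB : B b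
  · obtain ⟨q, hq, -⟩ := existsUnique_add_zsmul_mem_Ioc hk' x (-k)
    rw [smul_eq_mul, Set.mem_Ioc] at hq
    refine ⟨q, ?_⟩
    simp only [hB, and_true, not_true, and_false, or_false]
    omega
  · obtain ⟨q, hq, -⟩ := existsUnique_add_zsmul_mem_Ico hk' x (-k)
    rw [smul_eq_mul, Set.mem_Ico] at hq
    refine ⟨q, ?_⟩
    simp only [hB, and_true, not_false_iff, and_false, false_or]
    omega

theorem CoveringWalk.hasHarmoniousTransversal [Finite A] {k n : ℕ} {u : ℤ × A} {V S : Set (ℤ × A)}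
    (h : CoveringWalk u u V S n) (B : A → Prop) (hk : k ≠ 0) (hn : n = 2 * k * Nat.card A)
    (hV : centralBox k B ⊆ V) (hS : centralBox k B ⊆ S) : HasHarmoniousTransversal (2 * k) A := by
  have hindex := index_zmultiples_prodMk_zero (2 * k) A
  have : (AddSubgroup.zmultiples (((2 * k : ℕ) : ℤ), (0 : A))).FiniteIndex :=
    ⟨hindex ▸ mul_ne_zero (mul_ne_zero two_ne_zero hk) Nat.card_pos.ne'⟩
  exact (h.mono hV hS (hn.trans hindex.symm)).exists_isHarmoniousTransversal
    (exists_mem_centralBox hk B) subset_rfl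

/-- Steps are added alternately at the two ends of the walk. Both ends advance together in the
direction `δ`, so the sums of two consecutive terms advance at twice their pace. -/
theorem CoveringWalk.extend_ends {X Y δ : ℤ} {a b : A} {V S : Set (ℤ × A)} {n : ℕ}
    (h : CoveringWalk (X, a) (Y, b) V S n) (a' b' : A) (hδ : δ = 1 ∨ δ = -1) (r : ℕ) :
    CoveringWalk (X + δ * r, a) (Y + δ * r, b)
      (V ∪ ({z | 0 < δ * (z.1 - X) ∧ δ * (z.1 - X) ≤ r ∧ (z.2 = a ∨ z.2 = a')} ∪
        {z | 0 < δ * (z.1 - Y) ∧ δ * (z.1 - Y) ≤ r ∧ (z.2 = b ∨ z.2 = b')}))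
      (S ∪ {z | 0 < δ * (z.1 - (X + Y)) ∧ δ * (z.1 - (X + Y)) ≤ 2 * r ∧
        ((z.1 - (X + Y)) % 2 = 1 ∧ (z.2 = a + b ∨ z.2 = a + b') ∨
          (z.1 - (X + Y)) % 2 = 0 ∧ (z.2 = a' + b ∨ z.2 = a' + b'))}) (n + 4 * r) := by
  induction r with
  | zero =>
    have hzero : ∀ x : ℤ, x + δ * (0 : ℕ) = x := by simp
    rw [hzero, hzero]
    refine h.mono (Set.union_subset subset_rfl ?_) (Set.union_subset subset_rfl ?_) rfl <;>
      rintro z hz <;> simp only [Set.mem_union, Set.mem_ofPred_eq] at hz <;> omega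
  | succ r ih =>
    have hsucc : ∀ x : ℤ, x + δ * (r + 1 : ℕ) = x + δ * r + δ := fun x => by
      push_cast
      ring
    rw [hsucc, hsucc]
    refine ((((ih.reverse.cons _).snoc (Y + δ * r + δ, b')).snoc (X + δ * r + δ, a')).snoc _).mono
      ?_ ?_ (by ring) <;> rintro ⟨z, c⟩ hz <;> push_cast at hz <;>
      simp only [Set.mem_union, Set.mem_insert_iff, Set.mem_ofPred_eq, Prod.mk_add_mk,
        Prod.mk.injEq] at hz ⊢ <;> rcases hδ with rfl | rfl <;> grind

end Box

section Bases

theorem zmod_two_cases (c : ZMod 2) : c = 0 ∨ c = 1 := by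
  revert c
  decide

theorem hasHarmoniousTransversal_zmod_two_of_odd (r : ℕ) :
    HasHarmoniousTransversal (2 * (2 * r + 3)) (ZMod 2) := by
  have h₁ := (CoveringWalk.refl ((r : ℤ), (0 : ZMod 2)) |>.snoc (-r - 2, 0) |>.snoc (r, 1)
    |>.snoc (r + 2, 1) |>.snoc (r + 1, 1) |>.snoc (-r - 2, 1)).extend_ends 1 0 (Or.inr rfl) r
  have h₂ := (CoveringWalk.refl ((r : ℤ) + 2, (0 : ZMod 2)) |>.snoc (-r - 1, 0)
    |>.snoc (r + 1, 0) |>.snoc (-r - 1, 1)).extend_ends 1 0 (Or.inl rfl) r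
  have h := h₁.reverse |>.snoc (-2 * r - 3, 1) |>.append h₂ |>.snoc (2 * r + 3, 0)
    |>.snoc (-r - 2 + -1 * r, 1)
  refine h.hasHarmoniousTransversal (· = 0) (by omega)
    (by rw [Nat.card_zmod]; ring) ?_ ?_
  all_goals
    rintro ⟨x, b⟩ hx
    rcases zmod_two_cases b with rfl | rfl <;>
      simp (decide := true) only [centralBox, Set.mem_union, Set.mem_insert_iff,
        Set.mem_ofPred_eq, Set.mem_singleton_iff, Set.mem_empty_iff_false, Prod.mk_add_mk,
        Prod.mk.injEq, or_false, false_or, and_false, or_true, and_true] at hx ⊢ <;>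
      omega

theorem hasHarmoniousTransversal_zmod_two_of_even (r : ℕ) :
    HasHarmoniousTransversal (2 * (2 * r + 4)) (ZMod 2) := by
  have h₁ := (CoveringWalk.refl ((r : ℤ) + 1, (0 : ZMod 2)) |>.snoc (-r - 2, 0)
    |>.snoc (r + 2, 0) |>.snoc (-r - 2, 1)).extend_ends 1 0 (Or.inr rfl) (r + 1)
  have h₂ := (CoveringWalk.refl ((r : ℤ) + 3, (0 : ZMod 2)) |>.snoc (-r - 1, 0)
    |>.snoc (r + 3, 1) |>.snoc (r + 1, 1) |>.snoc (r + 2, 1) |>.snoc (-r - 1, 1)).extend_ends 1 0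
    (Or.inl rfl) r
  have h := h₁.reverse |>.snoc (-2 * r - 4, 1) |>.append h₂ |>.snoc (2 * r + 4, 0)
    |>.snoc (-r - 2 + -1 * ↑(r + 1), 1)
  refine h.hasHarmoniousTransversal (· = 0) (by omega)
    (by rw [Nat.card_zmod]; ring) ?_ ?_
  all_goals
    rintro ⟨x, b⟩ hx
    rcases zmod_two_cases b with rfl | rfl <;>
      simp (decide := true) only [centralBox, Set.mem_union, Set.mem_insert_iff,
        Set.mem_ofPred_eq, Set.mem_singleton_iff, Set.mem_empty_iff_false, Prod.mk_add_mk,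
        Prod.mk.injEq, or_false, false_or, and_false, or_true, and_true] at hx ⊢ <;>
      omega

theorem hasHarmoniousTransversal_four_zmod_two : HasHarmoniousTransversal 4 (ZMod 2) := by
  have h := CoveringWalk.refl ((0, 0) : ℤ × ZMod 2) |>.snoc (-1, 0) |>.snoc (-1, 1) |>.snoc (1, 1)
    |>.snoc (0, 1) |>.snoc (1, 0) |>.snoc (-2, 1) |>.snoc (2, 0) |>.snoc (0, 0)
  refine h.hasHarmoniousTransversal (k := 2) (· = 0) (by omega)
    (by rw [Nat.card_zmod]) ?_ ?_
  all_goals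
    rintro ⟨x, b⟩ hx
    rcases zmod_two_cases b with rfl | rfl <;>
      simp (decide := true) only [centralBox, Set.mem_insert_iff, Set.mem_ofPred_eq,
        Set.mem_singleton_iff, Set.mem_empty_iff_false, Prod.mk_add_mk,
        Prod.mk.injEq, or_false, false_or, and_false, and_true] at hx ⊢ <;>
      omega

theorem hasHarmoniousTransversal_zmod_two {k : ℕ} (hk : 2 ≤ k) :
    HasHarmoniousTransversal (2 * k) (ZMod 2) := by
  obtain rfl | hk := hk.eq_or_lt
  · exact hasHarmoniousTransversal_four_zmod_two
  obtain ⟨r, rfl | rfl⟩ : ∃ r, k = 2 * r + 4 ∨ k = 2 * r + 3 := ⟨(k - 3) / 2, by omega⟩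
  · exact hasHarmoniousTransversal_zmod_two_of_even r
  · exact hasHarmoniousTransversal_zmod_two_of_odd r

theorem hasHarmoniousTransversal_zmod_four {k : ℕ} (hk : 2 ≤ k) :
    HasHarmoniousTransversal (2 * k) (ZMod 4) := by
  obtain ⟨r, rfl⟩ : ∃ r, k = r + 2 := ⟨k - 2, by omega⟩
  have h₁ := (CoveringWalk.edge ((r : ℤ) + 1, (0 : ZMod 4)) (-1, 1)).extend_ends 1 3 (Or.inr rfl) r
  have h₂ := (CoveringWalk.edge ((r : ℤ) + 1, (2 : ZMod 4)) (-1, 0)).extend_ends 3 2 (Or.inr rfl) r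
  have h := h₁.reverse |>.snoc (-r - 2, 2) |>.snoc (0, 1) |>.snoc (r + 2, 0) |>.snoc (-1, 2)
    |>.snoc (r + 1, 1) |>.snoc (-1, 3) |>.snoc (r + 2, 1) |>.snoc (0, 3) |>.snoc (-r - 2, 3)
    |>.append h₂ |>.snoc (0, 0) |>.snoc (r + 1, 3) |>.snoc (0, 2) |>.snoc (-1 + -1 * r, 1)
  refine h.hasHarmoniousTransversal (fun b => b = 0 ∨ b = 1) (by omega)
    (by rw [Nat.card_zmod]; ring) ?_ ?_
  all_goals
    rintro ⟨x, b⟩ hx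
    rcases zmod_four_cases b with rfl | rfl | rfl | rfl <;>
      simp (decide := true) only [centralBox, Set.mem_union, Set.mem_insert_iff,
        Set.mem_ofPred_eq, Set.mem_singleton_iff, Prod.mk_add_mk, Prod.mk.injEq, or_false,
        false_or, and_false, or_true, and_true] at hx ⊢ <;>
      omega

theorem hasHarmoniousTransversal_zmod_two_prod_zmod_two {k : ℕ} (hk : 2 ≤ k) :
    HasHarmoniousTransversal (2 * k) (ZMod 2 × ZMod 2) := by
  obtain ⟨r, rfl⟩ : ∃ r, k = r + 2 := ⟨k - 2, by omega⟩
  have h₁ := (CoveringWalk.edge ((r : ℤ) + 1, ((0, 0) : ZMod 2 × ZMod 2)) (-1, (0, 0))).extend_ends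
    (1, 0) (0, 1) (Or.inr rfl) r
  have h₂ := (CoveringWalk.refl ((r : ℤ) + 1, ((0, 1) : ZMod 2 × ZMod 2)) |>.snoc (0, (0, 1))
    |>.snoc (r + 1, (1, 0)) |>.snoc (-1, (0, 1)) |>.snoc (r + 1, (1, 1)) |>.snoc (-1, (1, 0))
    |>.snoc (r + 2, (0, 0)) |>.snoc (0, (1, 0)) |>.snoc (r + 2, (1, 0))
    |>.snoc (-1, (1, 1))).extend_ends (1, 1) (1, 0) (Or.inr rfl) r
  have h := h₁.reverse |>.snoc (-r - 2, (0, 1)) |>.snoc (0, (0, 0)) |>.snoc (-r - 2, (1, 1))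
    |>.append h₂ |>.snoc (0, (1, 1)) |>.snoc (-1 + -1 * r, (0, 0))
  refine h.hasHarmoniousTransversal (fun b => b = (0, 0) ∨ b = (1, 0))
    (by omega) (by rw [Nat.card_prod, Nat.card_zmod]; ring) ?_ ?_
  all_goals
    rintro ⟨x, b⟩ hx
    rcases zmod_two_prod_zmod_two_cases b with rfl | rfl | rfl | rfl <;>
      simp (decide := true) only [centralBox, Set.mem_union, Set.mem_insert_iff,
        Set.mem_ofPred_eq, Set.mem_singleton_iff, Set.mem_empty_iff_false, Prod.mk_add_mk,
        Prod.mk.injEq, or_false, false_or, and_false, or_true, and_true] at hx ⊢ <;>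
      omega

theorem hasHarmoniousTransversal_two_zmod_four : HasHarmoniousTransversal 2 (ZMod 4) := by
  have h := CoveringWalk.refl ((0, 0) : ℤ × ZMod 4) |>.snoc (1, 0) |>.snoc (0, 1) |>.snoc (-1, 2)
    |>.snoc (1, 1) |>.snoc (-1, 3) |>.snoc (0, 3) |>.snoc (0, 2) |>.snoc (0, 0)
  refine h.hasHarmoniousTransversal (k := 1) (fun b => b = 0 ∨ b = 1) one_ne_zero
    (by rw [Nat.card_zmod]) ?_ ?_
  all_goals
    rintro ⟨x, b⟩ hx
    rcases zmod_four_cases b with rfl | rfl | rfl | rfl <;>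
      simp (decide := true) only [centralBox, Set.mem_insert_iff, Set.mem_ofPred_eq,
        Set.mem_singleton_iff, Set.mem_empty_iff_false, Prod.mk_add_mk,
        Prod.mk.injEq, or_false, false_or, and_false, or_true, and_true] at hx ⊢ <;>
      omega

theorem eq_neg_one_or_eq_zero_or_eq_one_of_mem_centralBox {A : Type*} [AddCommGroup A]
    {B : A → Prop} {x : ℤ} {b : A} (h : (x, b) ∈ centralBox 1 B) : x = -1 ∨ x = 0 ∨ x = 1 := by
  simp only [centralBox, Set.mem_ofPred_eq] at h
  omega

theorem hasHarmoniousTransversal_two_zmod_eight : HasHarmoniousTransversal 2 (ZMod 8) := by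
  have h := CoveringWalk.refl ((0, 0) : ℤ × ZMod 8) |>.snoc (0, 2) |>.snoc (1, 6) |>.snoc (-1, 3)
    |>.snoc (0, 4) |>.snoc (-1, 7) |>.snoc (1, 4) |>.snoc (0, 5) |>.snoc (0, 7) |>.snoc (0, 1)
    |>.snoc (0, 6) |>.snoc (1, 0) |>.snoc (-1, 5) |>.snoc (1, 1) |>.snoc (0, 3) |>.snoc (-1, 2)
    |>.snoc (0, 0)
  refine h.hasHarmoniousTransversal (k := 1)
    (fun b => b = 0 ∨ b = 1 ∨ b = 4 ∨ b = 6) one_ne_zero (by rw [Nat.card_zmod]) ?_ ?_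
  all_goals
    clear h
    rintro ⟨x, b⟩ hx
    rcases eq_neg_one_or_eq_zero_or_eq_one_of_mem_centralBox hx with rfl | rfl | rfl <;>
      simp (decide := true) only [centralBox, Set.mem_insert_iff, Set.mem_ofPred_eq,
        Set.mem_singleton_iff, Prod.mk_add_mk, Prod.mk.injEq, true_and, false_and, or_false,
        false_or] at hx ⊢ <;>
      revert b <;>
      decide

theorem hasHarmoniousTransversal_two_zmod_four_prod_zmod_two :
    HasHarmoniousTransversal 2 (ZMod 4 × ZMod 2) := by
  have h := CoveringWalk.refl ((0, (0, 0)) : ℤ × ZMod 4 × ZMod 2) |>.snoc (-1, (1, 0))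
    |>.snoc (1, (3, 0)) |>.snoc (-1, (0, 1)) |>.snoc (0, (3, 0)) |>.snoc (-1, (1, 1))
    |>.snoc (1, (2, 1)) |>.snoc (0, (1, 1)) |>.snoc (0, (1, 0)) |>.snoc (0, (3, 1))
    |>.snoc (0, (2, 1)) |>.snoc (0, (0, 1)) |>.snoc (1, (2, 0)) |>.snoc (-1, (3, 1))
    |>.snoc (0, (2, 0)) |>.snoc (1, (0, 0)) |>.snoc (0, (0, 0))
  refine h.hasHarmoniousTransversal (k := 1)
    (fun b => b = (0, 0) ∨ b = (3, 0) ∨ b = (2, 1) ∨ b = (2, 0)) one_ne_zero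
    (by rw [Nat.card_prod, Nat.card_zmod, Nat.card_zmod]) ?_ ?_
  all_goals
    clear h
    rintro ⟨x, b⟩ hx
    rcases eq_neg_one_or_eq_zero_or_eq_one_of_mem_centralBox hx with rfl | rfl | rfl <;>
      simp (decide := true) only [centralBox, Set.mem_insert_iff, Set.mem_ofPred_eq,
        Set.mem_singleton_iff, Prod.mk_add_mk, Prod.mk.injEq, true_and, false_and, or_false,
        false_or] at hx ⊢ <;>
      revert b <;>
      decide

end Bases

section Lifting

variable {D E : Type*} [AddCommGroup D] [AddCommGroup E]

theorem HasHarmoniousTransversal.congr {n : ℕ} (e : D ≃+ E) (h : HasHarmoniousTransversal n D) :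
    HasHarmoniousTransversal n E := by
  obtain ⟨a, ha⟩ := h
  refine ⟨_, ha.map ((AddMonoidHom.id ℤ).prodMap e.toAddMonoidHom)
    (fun y => ⟨(y.1, e.symm y.2), by simp⟩) (AddSubgroup.map_le_iff_le_comap.2 ?_) ?_⟩
  · simp [AddSubgroup.zmultiples_le]
  · rw [index_zmultiples_prodMk_zero, index_zmultiples_prodMk_zero, Nat.card_congr e.toEquiv]

theorem HasHarmoniousTransversal.of_weaves [Finite D] {A : Type*} [AddCommGroup A] {n : ℕ}
    (hn : n ≠ 0) {M : AddSubgroup D} (e : A ≃+ M)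
    (hweaves : ∀ θ : A →+ ℤ × D, Weaves θ (n * Nat.card (D ⧸ M)))
    (h : HasHarmoniousTransversal n (D ⧸ M)) : HasHarmoniousTransversal n D := by
  have hindex := index_zmultiples_prodMk_zero n D
  have : (AddSubgroup.zmultiples ((n : ℤ), (0 : D))).FiniteIndex :=
    ⟨hindex ▸ mul_ne_zero hn Nat.card_pos.ne'⟩
  let φ : ℤ × D →+ ℤ × (D ⧸ M) := (AddMonoidHom.id ℤ).prodMap (QuotientAddGroup.mk' M)
  have hmap : (AddSubgroup.zmultiples ((n : ℤ), (0 : D))).map φ =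
      AddSubgroup.zmultiples ((n : ℤ), (0 : D ⧸ M)) := AddMonoidHom.map_zmultiples φ _
  refine (hweaves ((AddMonoidHom.inr ℤ D).comp (M.subtype.comp e.toAddMonoidHom))
    ).exists_isHarmoniousTransversal (φ := φ)
    (Function.surjective_id.prodMap (QuotientAddGroup.mk'_surjective M)) ?_ ?_ ?_ (hmap ▸ h)
  · ext ⟨x, d⟩
    have hmem : d ∈ M ↔ ∃ c, (e c : D) = d :=
      ⟨fun hd => ⟨e.symm ⟨d, hd⟩, by simp⟩, by rintro ⟨c, rfl⟩; exact (e c).2⟩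
    simp [φ, AddMonoidHom.mem_ker, AddMonoidHom.mem_range, Prod.ext_iff, hmem, eq_comm (a := x)]
  · rw [hmap, index_zmultiples_prodMk_zero]
  · rw [hindex, mul_assoc, Nat.card_congr e.toEquiv, M.card_eq_card_quotient_mul_card_addSubgroup]

theorem nonempty_addEquiv_of_card_eq_four {A : Type*} [AddCommGroup A] (hA : Nat.card A = 4) :
    Nonempty (ZMod 4 ≃+ A) ∨ Nonempty (ZMod 2 × ZMod 2 ≃+ A) := by
  by_cases hcyclic : IsAddCyclic A
  · exact Or.inl ⟨hA ▸ zmodAddCyclicAddEquiv hcyclic⟩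
  · have : IsAddKleinFour A :=
      ⟨hA, (not_isAddCyclic_iff_exponent_eq_prime Nat.prime_two hA).1 hcyclic⟩
    exact Or.inr IsAddKleinFour.nonempty_addEquiv

theorem exists_addSubgroup_le_card_eq_pow [Finite D] {p : ℕ} (hp : p.Prime) {n : ℕ}
    {K : AddSubgroup D} (h : p ^ n ∣ Nat.card K) : ∃ M ≤ K, Nat.card M = p ^ n := by
  have := Fact.mk hp
  obtain ⟨M, hM⟩ := Sylow.exists_subgroup_card_pow_prime (G := Multiplicative K) p h
  exact ⟨M.toAddSubgroup'.map K.subtype, AddSubgroup.map_subtype_le _,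
    (AddSubgroup.card_map_of_injective K.subtype_injective).trans hM⟩

theorem exists_addSubgroup_le_card_eq_four_or_odd_prime [Finite D] {K : AddSubgroup D} {c : ℕ}
    (hc : 2 < c) (h : c ∣ Nat.card K) : ∃ M ≤ K, Nat.card M ∣ c ∧
      (Nat.card M = 4 ∨ (Nat.card M).Prime ∧ Odd (Nat.card M)) := by
  obtain h4 | ⟨p, hp, hpc, hodd⟩ := Nat.four_dvd_or_exists_odd_prime_and_dvd_of_two_lt hc
  · obtain ⟨M, hMK, hM⟩ :=
      exists_addSubgroup_le_card_eq_pow Nat.prime_two (n := 2) (h4.trans h)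
    exact ⟨M, hMK, hM ▸ h4, Or.inl hM⟩
  · obtain ⟨M, hMK, hM⟩ :=
      exists_addSubgroup_le_card_eq_pow hp (n := 1) (by simpa using hpc.trans h)
    rw [pow_one] at hM
    exact ⟨M, hMK, hM ▸ hpc, Or.inr ⟨hM ▸ hp, hM ▸ hodd⟩⟩

theorem HasHarmoniousTransversal.of_quotient [Finite D] {n : ℕ} (hn : Even n)
    {M : AddSubgroup D} (hM : Nat.card M = 4 ∨ (Nat.card M).Prime ∧ Odd (Nat.card M))
    (hcard : 4 ≤ n * Nat.card (D ⧸ M)) (h : HasHarmoniousTransversal n (D ⧸ M)) :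
    HasHarmoniousTransversal n D := by
  have hn0 : n ≠ 0 := by
    rintro rfl
    omega
  obtain hM | ⟨hp, hodd⟩ := hM
  · obtain ⟨⟨e⟩⟩ | ⟨⟨e⟩⟩ := nonempty_addEquiv_of_card_eq_four hM
    · exact h.of_weaves hn0 e (weaves_zmod_four (hn.mul_right _) (by omega))
    · exact h.of_weaves hn0 e (weaves_zmod_two_prod_zmod_two (hn.mul_right _) hcard)
  · have := Fact.mk hp
    have hcyclic : IsAddCyclic M := isAddCyclic_of_prime_card rfl
    exact h.of_weaves hn0 (zmodAddCyclicAddEquiv hcyclic) (weaves_zmod_of_odd hodd (by omega))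

theorem hasHarmoniousTransversal_of_even_card [Finite D] {k : ℕ} (hk : 2 ≤ k)
    (hD : Even (Nat.card D)) : HasHarmoniousTransversal (2 * k) D := by
  obtain ⟨c, hc⟩ := even_iff_exists_two_mul.1 hD
  have hpos : 0 < Nat.card D := Nat.card_pos
  clear hD
  induction c using Nat.strong_induction_on generalizing D with
  | _ c ih =>
    obtain rfl | rfl | hc2 : c = 1 ∨ c = 2 ∨ 2 < c := by omega
    · rw [mul_one] at hc
      have := Fact.mk Nat.prime_two
      have hcyclic : IsAddCyclic D := isAddCyclic_of_prime_card hc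
      have e := zmodAddCyclicAddEquiv hcyclic
      rw [hc] at e
      exact (hasHarmoniousTransversal_zmod_two hk).congr e
    · obtain ⟨⟨e⟩⟩ | ⟨⟨e⟩⟩ := nonempty_addEquiv_of_card_eq_four hc
      · exact (hasHarmoniousTransversal_zmod_four hk).congr e
      · exact (hasHarmoniousTransversal_zmod_two_prod_zmod_two hk).congr e
    · obtain ⟨M, -, ⟨d, rfl⟩, hM⟩ := exists_addSubgroup_le_card_eq_four_or_odd_prime
        (K := (⊤ : AddSubgroup D)) hc2 (by rw [AddSubgroup.card_top, hc]; exact dvd_mul_left c 2)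
      have hM0 : 2 ≤ Nat.card M := hM.elim (fun h => h ▸ by norm_num) fun h => h.1.two_le
      have hquot : Nat.card (D ⧸ M) = 2 * d := by
        have := M.card_eq_card_quotient_mul_card_addSubgroup
        nlinarith
      have hd : 0 < d := by
        have : 0 < Nat.card (D ⧸ M) := Nat.card_pos
        omega
      exact .of_quotient (even_two_mul k) hM (by nlinarith)
        (ih d (by nlinarith) hquot (by omega))

/-- The splitting of a group along a surjection `χ` with a section `σ`, as the codomain of `χ` times
its kernel. -/
noncomputable def prodKerAddEquivOfRightInverse (χ : D →+ E) (σ : E →+ D)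
    (h : Function.RightInverse σ χ) : E × χ.ker ≃+ D :=
  { toFun := σ.coprod χ.ker.subtype
    invFun x := (χ x, ⟨x - σ (χ x), by simp [AddMonoidHom.mem_ker, h (χ x)]⟩)
    left_inv := by
      rintro ⟨y, x, hx⟩
      rw [AddMonoidHom.mem_ker] at hx
      simp [hx, h y]
    right_inv := fun x => by simp
    map_add' := map_add _ }

theorem natCard_eq_mul_natCard_ker {χ : D →+ E} (hχ : Function.Surjective χ) :
    Nat.card D = Nat.card E * Nat.card χ.ker := by
  rw [← χ.ker.card_mul_index, AddSubgroup.index_ker, AddMonoidHom.range_eq_top.2 hχ,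
    AddSubgroup.card_top, mul_comm]

theorem nonempty_addEquiv_of_card_eq_eight {χ : D →+ ZMod 4} (hχ : Function.Surjective χ)
    (hD : Nat.card D = 8) : Nonempty (ZMod 8 ≃+ D) ∨ Nonempty (ZMod 4 × ZMod 2 ≃+ D) := by
  obtain ⟨x, hx⟩ := hχ 1
  by_cases hcyclic : IsAddCyclic D
  · exact Or.inl ⟨hD ▸ zmodAddCyclicAddEquiv hcyclic⟩
  have hker : Nat.card χ.ker = 2 := by
    have := natCard_eq_mul_natCard_ker hχ
    rw [hD, Nat.card_zmod] at this
    omega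
  have h4x : 4 • x = 0 := by
    have : Finite D := Nat.finite_of_card_ne_zero (by omega)
    have hdvd : addOrderOf x ∣ 2 ^ 3 := (addOrderOf_dvd_natCard x).trans hD.dvd
    obtain ⟨i, hi, hxi⟩ := (Nat.dvd_prime_pow Nat.prime_two).1 hdvd
    have hi3 : i ≠ 3 := by
      rintro rfl
      exact hcyclic (isAddCyclic_of_addOrderOf_eq_card x (hxi.trans hD.symm))
    exact addOrderOf_dvd_iff_nsmul_eq_zero.1 (hxi ▸ pow_dvd_pow 2 (by omega : i ≤ 2))
  let σ : ZMod 4 →+ D := ZMod.lift 4 ⟨zmultiplesHom D x, by simpa using mod_cast h4x⟩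
  have hσ : Function.RightInverse σ χ := fun z => by
    obtain ⟨z, rfl⟩ := ZMod.intCast_surjective z
    simp [σ, hx]
  have := Fact.mk Nat.prime_two
  have e := zmodAddCyclicAddEquiv (isAddCyclic_of_prime_card hker)
  rw [hker] at e
  exact Or.inr ⟨((AddEquiv.refl _).prodCongr e).trans (prodKerAddEquivOfRightInverse χ σ hσ)⟩

theorem hasHarmoniousTransversal_two_of_surjective_zmod_four [Finite D] {χ : D →+ ZMod 4}
    (hχ : Function.Surjective χ) : HasHarmoniousTransversal 2 D := by
  obtain ⟨c, hc⟩ : ∃ c, Nat.card χ.ker = c := ⟨_, rfl⟩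
  induction c using Nat.strong_induction_on generalizing D with
  | _ c ih =>
    have hD := natCard_eq_mul_natCard_ker hχ
    rw [hc, Nat.card_zmod] at hD
    have hDpos : 0 < Nat.card D := Nat.card_pos
    obtain rfl | rfl | rfl | hc2 : c = 0 ∨ c = 1 ∨ c = 2 ∨ 2 < c := by omega
    · omega
    · have hinj := (AddMonoidHom.ker_eq_bot_iff χ).1 (AddSubgroup.card_eq_one.1 hc)
      exact hasHarmoniousTransversal_two_zmod_four.congr (.symm (.ofBijective χ ⟨hinj, hχ⟩))
    · obtain ⟨⟨e⟩⟩ | ⟨⟨e⟩⟩ := nonempty_addEquiv_of_card_eq_eight hχ hD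
      · exact hasHarmoniousTransversal_two_zmod_eight.congr e
      · exact hasHarmoniousTransversal_two_zmod_four_prod_zmod_two.congr e
    · obtain ⟨M, hMχ, ⟨d, rfl⟩, hM⟩ :=
        exists_addSubgroup_le_card_eq_four_or_odd_prime hc2 hc.symm.dvd
      have hM0 : 2 ≤ Nat.card M := hM.elim (fun h => h ▸ by norm_num) fun h => h.1.two_le
      have hlift := QuotientAddGroup.lift_surjective_of_surjective M χ hχ hMχ
      have hquot : Nat.card (D ⧸ M) = 4 * d := by
        have := M.card_eq_card_quotient_mul_card_addSubgroup
        nlinarith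
      have hdpos : 0 < d := by
        have : 0 < Nat.card (D ⧸ M) := Nat.card_pos
        omega
      have hker := natCard_eq_mul_natCard_ker hlift
      rw [hquot, Nat.card_zmod] at hker
      exact .of_quotient even_two hM (by omega) (ih d (by nlinarith) hlift (by omega))

end Lifting

section ClosedWebLabelings

theorem IsHarmonious.of_addEquiv {V Γ Γ' : Type*} [AddCommGroup Γ] [AddCommGroup Γ']
    {G : SimpleGraph V} (e : Γ ≃+ Γ') (h : IsHarmonious G Γ) : IsHarmonious G Γ' := by
  obtain ⟨f, hf, hbij⟩ := h
  have hlabel : (fun x : G.edgeSet => inducedLabel (e ∘ f) (x : Sym2 V)) =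
      e ∘ fun x : G.edgeSet => inducedLabel f (x : Sym2 V) := by
    funext ⟨x, hx⟩
    induction x using Sym2.ind with
    | _ x y => exact (map_add e (f x) (f y)).symm
  exact ⟨e ∘ f, e.injective.comp hf, hlabel ▸ e.bijective.comp hbij⟩

variable {m n r v : ℕ} {D : Type*} [AddCommGroup D]

theorem addOrderOf_natCast_zero (hm : m ≠ 0) (hr : r ≠ 0) :
    addOrderOf ((r : ZMod (m * r)), (0 : D)) = m := by
  rw [Prod.addOrderOf_mk, addOrderOf_zero, Nat.lcm_one_right,
    ZMod.addOrderOf_coe _ (mul_ne_zero hm hr), Nat.gcd_eq_right (dvd_mul_left r m),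
    Nat.mul_div_cancel _ (Nat.pos_of_ne_zero hr)]

theorem index_zmultiples_natCast_zero (hm : m ≠ 0) (hr : r ≠ 0) :
    (AddSubgroup.zmultiples ((r : ZMod (m * r)), (0 : D))).index = r * Nat.card D := by
  have h := (AddSubgroup.zmultiples ((r : ZMod (m * r)), (0 : D))).card_mul_index
  rw [Nat.card_zmultiples, addOrderOf_natCast_zero hm hr, Nat.card_prod, Nat.card_zmod,
    mul_assoc] at h
  exact Nat.eq_of_mul_eq_mul_left (Nat.pos_of_ne_zero hm) h

theorem HasHarmoniousTransversal.exists_zmod_prod (hm : m ≠ 0) (hr : r ≠ 0)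
    (hrv : r.Coprime v) (h : HasHarmoniousTransversal (r * v) D) : ∃ a, IsHarmoniousTransversal
      (AddSubgroup.zmultiples ((r : ZMod (m * r)), (0 : ZMod v × D))) a := by
  obtain ⟨a, ha⟩ := h
  let φ : ℤ × D →+ ZMod (m * r) × ZMod v × D :=
    ((Int.castAddHom _).comp (AddMonoidHom.fst ℤ D)).prod
      ((Int.castAddHom _).prodMap (AddMonoidHom.id D))
  refine ⟨_, ha.map φ (fun ⟨x, y, d⟩ => ?_) (AddSubgroup.map_le_iff_le_comap.2 ?_) ?_⟩
  · obtain ⟨x, rfl⟩ := ZMod.intCast_surjective x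
    obtain ⟨z, hz⟩ := ZMod.intCast_surjective ((ZMod.chineseRemainder hrv).symm (x, y))
    rw [RingEquiv.eq_symm_apply, map_intCast, Prod.ext_iff] at hz
    obtain ⟨q, hq⟩ := (ZMod.intCast_eq_intCast_iff_dvd_sub _ _ _).1 hz.1.symm
    have hy : (z : ZMod v) = y := hz.2
    exact ⟨(z, d), q, by simp [φ, hy, ← Int.cast_sub, hq, mul_comm]⟩
  · rw [AddSubgroup.zmultiples_le, AddSubgroup.mem_comap]
    exact ⟨v, by simp [φ, mul_comm, Prod.zero_eq_mk]⟩
  · rw [index_zmultiples_natCast_zero hm hr, index_zmultiples_prodMk_zero, Nat.card_prod,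
      Nat.card_zmod, mul_assoc]

theorem HasHarmoniousTransversal.isHarmonious_closedWeb {u w : ℕ} (hm : m ≠ 0) (hn : 2 ≤ n)
    (hw : w = u * v) (huv : u.Coprime v) (hrv : r.Coprime v)
    (hcard : Nat.card (ZMod (2 * m * r) × ZMod w × D) = 2 * m * n)
    (h : HasHarmoniousTransversal (r * v) (ZMod u × D)) :
    IsHarmonious (closedWeb m n) (ZMod (2 * m * r) × ZMod w × D) := by
  subst hw
  have := NeZero.mk hm
  have : NeZero n := ⟨by omega⟩
  have hm2 : 2 * m ≠ 0 := mul_ne_zero two_ne_zero hm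
  have hr : r ≠ 0 := by
    rintro rfl
    simp [hm, this.ne] at hcard
  let e : ZMod (2 * m * r) × ZMod v × ZMod u × D ≃+ ZMod (2 * m * r) × ZMod (u * v) × D :=
    (AddEquiv.refl _).prodCongr (AddEquiv.prodAssoc.symm.trans
      (((ZMod.chineseRemainder huv).toAddEquiv.trans AddEquiv.prodComm).symm.prodCongr
        (AddEquiv.refl D)))
  obtain ⟨a, ha⟩ := h.exists_zmod_prod hm2 hr hrv
  refine (ha.isHarmonious_closedWeb hn ?_ (addOrderOf_natCast_zero hm2 hr)).of_addEquiv e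
  rw [← Nat.card_congr e.toEquiv, Nat.card_prod, Nat.card_zmod, mul_assoc] at hcard
  rw [index_zmultiples_natCast_zero hm2 hr, Nat.eq_of_mul_eq_mul_left (by positivity) hcard]

variable {w : ℕ} [NeZero w] [Finite D]

theorem isHarmonious_closedWeb_zmod_prod_of_even (hm : m ≠ 0) (hn : 2 ≤ n) (hr : Even r)
    (hw : Even w) (hrw : 4 ≤ r ∨ 4 ≤ w)
    (hcard : Nat.card (ZMod (2 * m * r) × ZMod w × D) = 2 * m * n) :
    IsHarmonious (closedWeb m n) (ZMod (2 * m * r) × ZMod w × D) := by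
  have heven : ∀ u, Even u → Even (Nat.card (ZMod u × D)) := fun u hu => by
    rw [Nat.card_prod, Nat.card_zmod]
    exact hu.mul_right _
  obtain ⟨k, rfl⟩ := even_iff_exists_two_mul.1 hr
  obtain ⟨p, rfl⟩ := even_iff_exists_two_mul.1 hw
  have hk : k ≠ 0 := by
    rintro rfl
    simp at hcard
    omega
  obtain hk2 | rfl : 2 ≤ k ∨ k = 1 := by omega
  · exact HasHarmoniousTransversal.isHarmonious_closedWeb hm hn (mul_one _).symm
      (Nat.coprime_one_right _) (Nat.coprime_one_right _) hcard
      ((mul_one (2 * k)).symm ▸ hasHarmoniousTransversal_of_even_card hk2 (heven _ hw))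
  obtain hp | hp := p.even_or_odd
  · have hdvd : 4 ∣ 2 * p := Nat.mul_dvd_mul_left 2 hp.two_dvd
    have hχ : Function.Surjective
        ((ZMod.castHom hdvd (ZMod 4)).toAddMonoidHom.comp (AddMonoidHom.fst _ D)) :=
      (ZMod.castHom_surjective hdvd).comp Prod.fst_surjective
    exact HasHarmoniousTransversal.isHarmonious_closedWeb hm hn (mul_one _).symm
      (Nat.coprime_one_right _) (Nat.coprime_one_right _) hcard
      (hasHarmoniousTransversal_two_of_surjective_zmod_four hχ)
  · exact HasHarmoniousTransversal.isHarmonious_closedWeb hm hn rfl (Nat.coprime_two_left.2 hp)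
      (Nat.coprime_two_left.2 hp) hcard
      (hasHarmoniousTransversal_of_even_card (by omega) (heven _ even_two))

theorem isHarmonious_closedWeb_zmod_prod_of_odd (hm : m ≠ 0) (hn : 2 ≤ n) (hr : Odd r)
    (hw : Even w) (hw4 : 4 ≤ w) (hD : Even (Nat.card D))
    (hcard : Nat.card (ZMod (2 * m * r) × ZMod w × D) = 2 * m * n) :
    IsHarmonious (closedWeb m n) (ZMod (2 * m * r) × ZMod w × D) := by
  have heven : ∀ u, Even (Nat.card (ZMod u × D)) := fun u => by
    rw [Nat.card_prod]
    exact hD.mul_left _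
  obtain rfl | hr3 : r = 1 ∨ 3 ≤ r := by grind
  · obtain ⟨k, rfl⟩ := even_iff_exists_two_mul.1 hw
    exact HasHarmoniousTransversal.isHarmonious_closedWeb hm hn (one_mul _).symm
      (Nat.coprime_one_left _) (Nat.coprime_one_left _) hcard
      ((one_mul (2 * k)).symm ▸ hasHarmoniousTransversal_of_even_card (by omega) (heven 1))
  · obtain ⟨j, u, hu, rfl⟩ := Nat.exists_eq_two_pow_mul_odd (NeZero.ne w)
    obtain ⟨j, rfl⟩ : ∃ i, j = i + 1 := Nat.exists_eq_succ_of_ne_zero fun hj => by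
      simp [hj, ← Nat.not_odd_iff_even, hu] at hw
    have := NeZero.of_pos hu.pos
    have hk : r * 2 ^ (j + 1) = 2 * (r * 2 ^ j) := by ring
    have hk2 : 2 ≤ r * 2 ^ j := le_mul_of_le_of_one_le (by omega) Nat.one_le_two_pow
    exact HasHarmoniousTransversal.isHarmonious_closedWeb hm hn (mul_comm _ _)
      (Nat.Coprime.pow_right _ (Nat.coprime_two_right.2 hu))
      (Nat.Coprime.pow_right _ (Nat.coprime_two_right.2 hr)) hcard
      (hk ▸ hasHarmoniousTransversal_of_even_card hk2 (heven u))

end ClosedWebLabelings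

section NestedForm

variable {Γ : Type*} [AddCommGroup Γ] {t : ℕ}

theorem IsNestedForm.dvd {ν : Fin t → ℕ} (hν : IsNestedForm Γ ν) {i j : Fin t} (hij : i ≤ j) :
    ν j ∣ ν i := by
  obtain ⟨j, hj⟩ := j
  obtain ⟨d, rfl⟩ := Nat.exists_eq_add_of_le (show (i : ℕ) ≤ j from hij)
  induction d with
  | zero => exact dvd_rfl
  | succ d ih =>
    exact (hν.2.1 ⟨i + d, by omega⟩ ⟨i + (d + 1), hj⟩ rfl).trans (ih _ (Nat.le_add_right i d))

theorem IsNestedForm.four_le_of_odd {ν : Fin t → ℕ} (hν : IsNestedForm Γ ν) {i j : Fin t}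
    (hij : i ≤ j) (hi : Even (ν i)) (hj : Odd (ν j)) : 4 ≤ ν i := by
  have h2 : 2 * ν j ∣ ν i :=
    (Nat.coprime_two_left.2 hj).mul_dvd_of_dvd_of_dvd hi.two_dvd (hν.dvd hij)
  have := Nat.le_of_dvd (by linarith [hν.1 i]) h2
  linarith [hν.1 j]

theorem IsNestedForm.nonempty_addEquiv_prod {ν : Fin (t + 2) → ℕ} (hν : IsNestedForm Γ ν) :
    Nonempty (ZMod (ν 0) × ZMod (ν 1) × (∀ i : Fin t, ZMod (ν i.succ.succ)) ≃+ Γ) := by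
  obtain ⟨-, -, ⟨e⟩⟩ := hν
  have hsplit := fun (s : ℕ) (μ : Fin (s + 1) → ℕ) =>
    (Fin.consLinearEquiv ℤ fun i => ZMod (μ i)).toAddEquiv
  exact ⟨((AddEquiv.refl _).prodCongr (hsplit t fun i => ν i.succ)).trans
    ((hsplit (t + 1) ν).trans e.symm)⟩

end NestedForm

theorem mainTheorem10_general {m n t : ℕ} (hm : m ≠ 0) (hn : 2 ≤ n) {Γ : Type*} [AddCommGroup Γ]
    (hΓ : Nat.card Γ = 2 * m * n) {ν : Fin (t + 2) → ℕ} (hν : IsNestedForm Γ ν)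
    (hν1 : Even (ν 1)) (h : 8 * m ∣ ν 0 ∨
      4 ≤ ν 1 ∧ (4 * m ∣ ν 0 ∨ 2 * m ∣ ν 0 ∧ ∃ i : Fin t, Even (ν i.succ.succ))) :
    IsHarmonious (closedWeb m n) Γ := by
  have : ∀ i, NeZero (ν i) := fun i => .of_pos (two_pos.trans_le (hν.1 i))
  have hm2 : 0 < 2 * m := by omega
  obtain ⟨r, hr⟩ : 2 * m ∣ ν 0 := by
    obtain h | ⟨-, h | ⟨h, -⟩⟩ := h
    · exact (Nat.mul_dvd_mul_right (by norm_num) m).trans h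
    · exact (Nat.mul_dvd_mul_right (by norm_num) m).trans h
    · exact h
  have hdvd : ∀ k, 2 * k * m ∣ ν 0 → k ∣ r := fun k hk => by
    rw [hr, mul_right_comm] at hk
    exact Nat.dvd_of_mul_dvd_mul_left hm2 hk
  have hr0 : 0 < r := Nat.pos_of_ne_zero (right_ne_zero_of_mul (hr ▸ NeZero.ne (ν 0)))
  obtain ⟨e⟩ := hν.nonempty_addEquiv_prod
  rw [← Nat.card_congr e.toEquiv, hr] at hΓ
  refine .of_addEquiv e (hr ▸ ?_)
  obtain hr2 | hr2 := r.even_or_odd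
  · exact isHarmonious_closedWeb_zmod_prod_of_even hm hn hr2 hν1
      (h.imp (fun h => Nat.le_of_dvd hr0 (hdvd 4 h)) And.left) hΓ
  · obtain h | ⟨h4, h | ⟨-, i, hi⟩⟩ := h
    · exact absurd ((by norm_num : 2 ∣ 4).trans (hdvd 4 h)) hr2.not_two_dvd_nat
    · exact absurd (hdvd 2 h) hr2.not_two_dvd_nat
    refine isHarmonious_closedWeb_zmod_prod_of_odd hm hn hr2 hν1 h4 ?_ hΓ
    simp only [Nat.card_pi, Nat.card_zmod]
    exact even_iff_two_dvd.2 (hi.two_dvd.trans (Finset.dvd_prod_of_mem _ (Finset.mem_univ i)))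

theorem mainTheorem10 (m n : ℕ) (hm : 2 ≤ m) (hn : 4 ≤ n) (hn_even : Even n)
    (Γ : Type*) [AddCommGroup Γ] (hΓ : Nat.card Γ = 2 * m * n)
    (t : ℕ) (ht : 2 ≤ t) (ν : Fin t → ℕ) (hν : IsNestedForm Γ ν)
    (hK : ∃ K : AddSubgroup Γ, IsAddCyclic K ∧ Nat.card K = 2 * m)
    (hcases :
      (ν ⟨0, Nat.zero_lt_of_lt ht⟩ ≡ 0 [MOD 8 * m] ∧ ν ⟨1, ht⟩ ≡ 0 [MOD 2]) ∨
      (ν ⟨0, Nat.zero_lt_of_lt ht⟩ ≡ 0 [MOD 4 * m] ∧ ν ⟨1, ht⟩ ≡ 0 [MOD 2] ∧ 4 ≤ ν ⟨1, ht⟩) ∨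
      (∃ ht3 : 3 ≤ t, ν ⟨0, Nat.zero_lt_of_lt ht⟩ ≡ 0 [MOD 2 * m] ∧ ν ⟨1, ht⟩ ≡ 0 [MOD 4] ∧
        ν ⟨2, ht3⟩ ≡ 0 [MOD 2]) ∨
      (∃ ht3 : 3 ≤ t, ν ⟨0, Nat.zero_lt_of_lt ht⟩ ≡ 0 [MOD 2 * m] ∧ ν ⟨2, ht3⟩ ≡ 0 [MOD 2] ∧
        1 < ν ⟨t - 1, Nat.sub_one_lt_of_lt ht⟩ ∧ Odd (ν ⟨t - 1, Nat.sub_one_lt_of_lt ht⟩))) :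
    IsHarmonious (closedWeb m n) Γ := by
  obtain ⟨s, rfl⟩ := Nat.exists_eq_add_of_le' ht
  have hharmonious := mainTheorem10_general (by omega) (by omega) hΓ hν
  simp only [Nat.modEq_zero_iff_dvd, ← even_iff_two_dvd] at hcases
  obtain ⟨h0, h1⟩ | ⟨h0, h1, h4⟩ | ⟨ht3, h0, h1, h2⟩ | ⟨ht3, h0, h2, -, hodd⟩ := hcases
  · exact hharmonious h1 (Or.inl h0)
  · exact hharmonious h1 (Or.inr ⟨h4, Or.inl h0⟩)
  · have h4 := Nat.le_of_dvd (two_pos.trans_le (hν.1 _)) h1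
    exact hharmonious (even_iff_two_dvd.2 (dvd_trans (by norm_num) h1))
      (Or.inr ⟨h4, Or.inr ⟨h0, ⟨0, by omega⟩, h2⟩⟩)
  · have h1 := even_iff_two_dvd.2 (h2.two_dvd.trans (hν.dvd (i := 1) (by simp [Fin.le_def])))
    have h4 := hν.four_le_of_odd (by simp [Fin.le_def]) h1 hodd
    exact hharmonious h1 (Or.inr ⟨h4, Or.inr ⟨h0, ⟨0, by omega⟩, h2⟩⟩)
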